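/- **Proposition 4.3.** Let $d\ge 1$, $1\le p\le\infty$ and $r>0$, and let $m\in\mathbb N$ be the natural number with $m-1\le r<m$. For $f:\mathbb R^d\to\mathbb C$, $j\in\{1,\dots,d\}$ and $t\in\mathbb R$ put $$\Delta^m_{t,j}f(x)=\sum_{\ell=0}^m(-1)^{m-\ell}\binom m\ell f(x_1,\dots,x_{j-1},x_j+\ell t,x_{j+1},\dots,x_d),$$ and for $e\subset\{1,\dots,d\}$, $h\in\mathbb R^d$ and $t\in(0,1]^d$ put $$\Delta_h^{\bar m,e}=\prod_{i\in e}\Delta^m_{h_i,i}\quad(\Delta_h^{\bar m,\emptyset}=\mathrm{Id}),\qquad \omega^e_{\bar m}(f,t)_p=\sup_{|h_i|<t_i,\ i\in e}\|\Delta_h^{\bar m,e}f\,|\,L_p(\mathbb R^d)\|.$$ The Besov space of dominating mixed smoothness $S^r_{p,p}B(\mathbb R^d)$ is the collection of all $f\in L_p(\mathbb R^d)$ (complex-valued) such that $$\|f|S^r_{p,p}B(\mathbb R^d)\|=\sum_{e\subset\{1,\dots,d\}}\Big(\sum_{k\in\mathbb N_0^d(e)}2^{r|k|_1p}\,\omega^e_{\bar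 m}(f,2^{-k})_p^p\Big)^{1/p}<\infty$$ (usual modification, a supremum over $k$, if $p=\infty$), where $\mathbb N_0^d(e)=\{k\in\mathbb N_0^d: k_i=0\text{ if }i\notin e\}$, $|k|_1=k_1+\dots+k_d$ and $2^{-k}=(2^{-k_1},\dots,2^{-k_d})$. Let $\psi\in C_0^\infty(\mathbb R^d)$ be non-negative with $\sum_{\mu\in\mathbb Z^d}\psi(x-\mu)=1$ for all $x\in\mathbb R^d$, and put $\psi_\mu(x)=\psi(x-\mu)$. Then there are constants $c,C>0$, depending only on $d,p,r,\psi$, such that for all $f\in S^r_{p,p}B(\mathbb R^d)$ every $\psi_\mu f$ belongs to $S^r_{p,p}B(\mathbb R^d)$ and $$c\,\|f|S^r_{p,p}B(\mathbb R^d)\|\le\Big(\sum_{\mu\in\mathbb Z^d}\|\psi_\mu f|S^r_{p,p}B(\mathbb R^d)\|^p\Big)^{1/p}\le C\,\|f|S^r_{p,p}B(\mathbb R^d)\|$$ (with the supremum over $\mu$ in the middle if $p=\infty$). -/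

import Mathlib

open MeasureTheory Finset
open scoped ENNReal ContDiff

namespace MixedBesov

/-- The `m`-th order difference in direction `j` with step `t`, for functions on `ℝ^d` with complex
values: `(Δ_{t,j}^m f)(x) = ∑_{ℓ=0}^m (-1)^(m-ℓ) (m choose ℓ) f(x₁, …, x_j + ℓ t, …, x_d)`,
bundled as a linear operator. -/
def partialDiff {d : ℕ} (m : ℕ) (t : ℝ) (j : Fin d) : Module.End ℂ ((Fin d → ℝ) → ℂ) where
  toFun f x := ∑ l ∈ Finset.range (m + 1),
    (-1 : ℂ) ^ (m - l) * (m.choose l : ℂ) * f (x + Pi.single j ((l : ℝ) * t))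
  map_add' f g := by
    funext x
    simp only [Pi.add_apply, mul_add, Finset.sum_add_distrib]
  map_smul' c f := by
    funext x
    simp only [Pi.smul_apply, smul_eq_mul, RingHom.id_apply, Finset.mul_sum]
    exact Finset.sum_congr rfl fun l _ => by ring

/-- Directional differences commute. -/
theorem partialDiff_commute {d : ℕ} (m n : ℕ) (s t : ℝ) (i j : Fin d) :
    Commute (partialDiff m s i) (partialDiff n t j) := by
  refine LinearMap.ext fun f => funext fun x => ?_
  simp only [Module.End.mul_apply, partialDiff, LinearMap.coe_mk, AddHom.coe_mk, Finset.mul_sum]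
  rw [Finset.sum_comm]
  refine Finset.sum_congr rfl fun a _ => Finset.sum_congr rfl fun b _ => ?_
  rw [add_right_comm]
  ring

/-- The directional differences `Δ_{h_i,i}^m`, `i ∈ e`, commute pairwise. -/
theorem partialDiff_pairwise {d : ℕ} (m : ℕ) (e : Finset (Fin d)) (h : Fin d → ℝ) :
    (e : Set (Fin d)).Pairwise (Function.onFun Commute fun i => partialDiff m (h i) i) :=
  fun i _ j _ _ => partialDiff_commute m m (h i) (h j) i j

/-- The mixed difference operator `Δ_h^{m̄,e} = ∏_{i ∈ e} Δ_{h_i,i}^m` (composition of the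
commuting directional differences), `m̄ = (m, …, m)`; it is the identity for `e = ∅`. -/
noncomputable def mixedDiff {d : ℕ} (m : ℕ) (e : Finset (Fin d)) (h : Fin d → ℝ) :
    Module.End ℂ ((Fin d → ℝ) → ℂ) :=
  e.noncommProd (fun i => partialDiff m (h i) i) (partialDiff_pairwise m e h)

/-- The modulus of smoothness
`ω_{m̄}^e(f,t)_p = sup { ‖Δ_h^{m̄,e} f | L_p(ℝ^d)‖ : |h_i| < t_i for i ∈ e }`. -/
noncomputable def modulus {d : ℕ} (m : ℕ) (e : Finset (Fin d)) (p : ℝ≥0∞)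
    (f : (Fin d → ℝ) → ℂ) (t : Fin d → ℝ) : ℝ≥0∞ :=
  ⨆ (h : Fin d → ℝ) (_ : ∀ i ∈ e, |h i| < t i), eLpNorm (mixedDiff m e h f) p volume

/-- `(∑_i a_i^p)^{1/p}` for a nonnegative family, with the usual modification `sup_i a_i` for
`p = ∞`; the value may be `∞`. -/
noncomputable def lpSum {ι : Type*} (p : ℝ≥0∞) (a : ι → ℝ≥0∞) : ℝ≥0∞ :=
  if p = ⊤ then ⨆ i, a i else (∑' i, a i ^ p.toReal) ^ (1 / p.toReal)

/-- The (extended) norm of the Besov space of dominating mixed smoothness `S^r_{p,p}B(ℝ^d)`: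
`∑_{e ⊆ [d]} (∑_{k ∈ ℕ₀^d(e)} (2^{r|k|₁} ω_{m̄}^e(f, 2^{-k})_p)^p)^{1/p}`,
where `ℕ₀^d(e)` is the set of all `k ∈ ℕ₀^d` with `k_i = 0` for `i ∉ e`, and `m = ⌊r⌋ + 1` is the
natural number with `m - 1 ≤ r < m`. -/
noncomputable def besovNorm {d : ℕ} (r : ℝ) (p : ℝ≥0∞) (f : (Fin d → ℝ) → ℂ) : ℝ≥0∞ :=
  ∑ e : Finset (Fin d),
    lpSum p (fun k : {k : Fin d → ℕ // ∀ i, i ∉ e → k i = 0} =>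
      ENNReal.ofReal ((2 : ℝ) ^ (r * ∑ i, (k.1 i : ℝ))) *
        modulus (⌊r⌋₊ + 1) e p f (fun i => (1 / 2 : ℝ) ^ k.1 i))

/-- `f ∈ S^r_{p,p}B(ℝ^d)`: `f ∈ L_p(ℝ^d)` and the norm is finite. -/
def MemBesov {d : ℕ} (r : ℝ) (p : ℝ≥0∞) (f : (Fin d → ℝ) → ℂ) : Prop :=
  MemLp f p volume ∧ besovNorm r p f < ⊤

/-- The product `ψ_μ f`, where `ψ_μ(x) = ψ(x - μ)`, `μ ∈ ℤ^d`. -/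
def localize {d : ℕ} (ψ : (Fin d → ℝ) → ℝ) (μ : Fin d → ℤ) (f : (Fin d → ℝ) → ℂ) :
    (Fin d → ℝ) → ℂ :=
  fun x => (ψ (fun i => x i - (μ i : ℝ)) : ℂ) * f x

end MixedBesov

/-! Finite differences are elements of the group algebra `ℂ[ℝ^d]` acting by translations. This
algebra is commutative, so every identity between differences becomes a polynomial identity in the
shifts. Translations are isometries of `L_p`, so each such identity gives a norm estimate.

Lower estimate. A difference with steps at most 1 sees only a bounded neighbourhood of a point,
where only a bounded number of the `ψ_μ f` are nonzero and where they add up to `f`. Hence the `L_p`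
norm of a difference of `f` is at most a constant times the `ℓ_p` sum over `μ` of the norms of the
same difference of `ψ_μ f`. Passing to suprema and interchanging two `ℓ_p` sums gives the claim
(`exists_besovNorm_le_lpSum_localize`).

Upper estimate. Three obstacles occur. (1) The supremum over steps stands inside the sum over `μ`,
and the optimal step depends on `μ`. An algebraic identity bounds a difference with step `h` by
differences with steps involving a free parameter `u`. Averaging over `u` replaces the supremum by
an integral, which commutes with the sum (`exists_lpSum_orderModulus_le`). (2) For a fixed step `v`,
the Leibniz rule, smoothness of `ψ` and finite overlap bound the sum over `μ` by terms `∏ |v_i|^(n_i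
- κ_i) ‖Δ_v^κ f‖` with `κ ≤ n` (`exists_lpSum_localize_le`). With `|v_i|` of order at most
`2^{-k_i}`, the weight `2^{r k_i}` drops to `2^{(r - m + κ_i) k_i}`. (3) The differences of lower
order `κ` must return to order `m` or 0 in each direction. A Marchaud inequality raises the order by
one. Since `r - m < 0`, its iteration over dyadic scales converges geometrically, and the boundary
term at scale 1 drops the direction altogether (`exists_orderNorm_le`,
`exists_orderNorm_le_besovNorm`). -/

namespace MixedBesov

/-! ### Differences as elements of the group algebra of translations -/

/-- The translation operators `(T_y f)(x) = f (x + y)`. -/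
def translation (H : Type*) [AddCommGroup H] : Multiplicative H →* Module.End ℂ (H → ℂ) where
  toFun y :=
    { toFun := fun f x => f (x + y.toAdd)
      map_add' := fun _ _ => rfl
      map_smul' := fun _ _ => rfl }
  map_one' := by ext f x; simp
  map_mul' y z := by ext f x; simp [add_assoc]

/-- The group algebra `ℂ[H]` acting on functions on `H` through translations. -/
noncomputable def act {H : Type*} [AddCommGroup H] :
    AddMonoidAlgebra ℂ H →ₐ[ℂ] Module.End ℂ (H → ℂ) :=
  AddMonoidAlgebra.lift ℂ _ H (translation H)

theorem act_single {H : Type*} [AddCommGroup H] (y : H) (c : ℂ) (f : H → ℂ) (x : H) :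
    act (AddMonoidAlgebra.single y c) f x = c * f (x + y) := by
  simp [act, AddMonoidAlgebra.lift_single, translation]

theorem act_mul {H : Type*} [AddCommGroup H] (a b : AddMonoidAlgebra ℂ H) (f : H → ℂ) :
    act (a * b) f = act a (act b f) := by
  rw [map_mul]; rfl

theorem act_one {H : Type*} [AddCommGroup H] (f : H → ℂ) :
    act (1 : AddMonoidAlgebra ℂ H) f = f := by
  rw [map_one]; rfl

theorem act_add {H : Type*} [AddCommGroup H] (a b : AddMonoidAlgebra ℂ H) (f : H → ℂ) :
    act (a + b) f = act a f + act b f := by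
  rw [map_add]; rfl

theorem act_sub {H : Type*} [AddCommGroup H] (a b : AddMonoidAlgebra ℂ H) (f : H → ℂ) :
    act (a - b) f = act a f - act b f := by
  rw [map_sub]; rfl

theorem act_smul {H : Type*} [AddCommGroup H] (c : ℂ) (a : AddMonoidAlgebra ℂ H) (f : H → ℂ) :
    act (c • a) f = c • act a f := by
  rw [map_smul]; rfl

theorem act_sum {H ι : Type*} [AddCommGroup H] (s : Finset ι) (a : ι → AddMonoidAlgebra ℂ H)
    (f : H → ℂ) : act (∑ i ∈ s, a i) f = ∑ i ∈ s, act (a i) f := by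
  rw [map_sum, LinearMap.sum_apply]

/-- The group algebra of `ℝ^d`. -/
abbrev TransAlg (d : ℕ) := AddMonoidAlgebra ℂ (Fin d → ℝ)

/-- The translation by `t` in direction `i`. -/
noncomputable def shift {d : ℕ} (t : ℝ) (i : Fin d) : TransAlg d :=
  AddMonoidAlgebra.single (Pi.single i t) 1

/-- The first order difference in direction `i` with step `t`. -/
noncomputable def diff {d : ℕ} (t : ℝ) (i : Fin d) : TransAlg d := shift t i - 1

/-- The mixed difference of order `n i` and step `h i` in each direction `i`. -/
noncomputable def multiDiff {d : ℕ} (n : Fin d → ℕ) (h : Fin d → ℝ) : TransAlg d :=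
  ∏ i, diff (h i) i ^ n i

/-- The multi-index with entries `m` on `e` and `0` elsewhere. -/
def constOrder {d : ℕ} (m : ℕ) (e : Finset (Fin d)) : Fin d → ℕ := fun i => if i ∈ e then m else 0

theorem shift_add {d : ℕ} (s t : ℝ) (i : Fin d) : shift (s + t) i = shift s i * shift t i := by
  simp [shift, AddMonoidAlgebra.single_mul_single, Pi.single_add]

theorem shift_zero {d : ℕ} (i : Fin d) : shift 0 i = 1 := by
  simp [shift, AddMonoidAlgebra.one_def]

theorem shift_nat_mul {d : ℕ} (l : ℕ) (t : ℝ) (i : Fin d) : shift (l * t) i = shift t i ^ l := by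
  induction l with
  | zero => simp [shift_zero]
  | succ l ih => rw [pow_succ, ← ih, ← shift_add]; congr 1; push_cast; ring

theorem act_shift {d : ℕ} (t : ℝ) (i : Fin d) (f : (Fin d → ℝ) → ℂ) (x : Fin d → ℝ) :
    act (shift t i) f x = f (x + Pi.single i t) := by
  simp [shift, act_single]

theorem act_diff {d : ℕ} (t : ℝ) (i : Fin d) (f : (Fin d → ℝ) → ℂ) (x : Fin d → ℝ) :
    act (diff t i) f x = f (x + Pi.single i t) - f x := by
  rw [diff, act_sub, act_one, Pi.sub_apply, act_shift]

/-- This is the binomial theorem for `(shift t i - 1) ^ m` in the group algebra. -/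
theorem partialDiff_eq_act {d : ℕ} (m : ℕ) (t : ℝ) (i : Fin d) :
    partialDiff m t i = act (diff t i ^ m) := by
  refine LinearMap.ext fun f => funext fun x => ?_
  rw [diff, sub_eq_add_neg, add_pow, act_sum, Finset.sum_apply]
  simp only [partialDiff, LinearMap.coe_mk, AddHom.coe_mk]
  refine Finset.sum_congr rfl fun l _ => ?_
  have : shift t i ^ l * (-1) ^ (m - l) * ((m.choose l : ℕ) : TransAlg d)
      = ((-1 : ℂ) ^ (m - l) * (m.choose l : ℂ)) • shift (l * t) i := by
    rw [shift_nat_mul, Algebra.smul_def, map_mul, map_pow, map_neg, map_one, map_natCast]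
    ring
  rw [this, act_smul, Pi.smul_apply, act_shift, smul_eq_mul]

theorem multiDiff_constOrder {d : ℕ} (m : ℕ) (e : Finset (Fin d)) (h : Fin d → ℝ) :
    multiDiff (constOrder m e) h = ∏ i ∈ e, diff (h i) i ^ m := by
  simp only [multiDiff, constOrder, pow_ite, pow_zero]
  rw [Finset.prod_ite_mem, Finset.univ_inter]

/-- In the commutative group algebra the noncommutative product is an ordinary one, and `act`, being
multiplicative, carries it over to operators. -/
theorem mixedDiff_eq_act {d : ℕ} (m : ℕ) (e : Finset (Fin d)) (h : Fin d → ℝ) :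
    mixedDiff m e h = act (multiDiff (constOrder m e) h) := by
  rw [multiDiff_constOrder, ← Finset.noncommProd_eq_prod]
  have comm : (e : Set (Fin d)).Pairwise (Function.onFun Commute fun i => diff (h i) i ^ m) :=
    fun i _ j _ _ => Commute.all _ _
  exact (Finset.noncommProd_congr rfl (fun i _ => partialDiff_eq_act m (h i) i) _).trans
    (Finset.map_noncommProd e _ comm act).symm

theorem diff_nat_mul {d : ℕ} (N : ℕ) (t : ℝ) (i : Fin d) :
    diff (N * t) i = (∑ l ∈ range N, shift t i ^ l) * diff t i := by
  rw [diff, diff, shift_nat_mul, geom_sum_mul]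

/-! ### Boundedness on `L_p` -/

theorem aestronglyMeasurable_act {d : ℕ} (a : TransAlg d) {f : (Fin d → ℝ) → ℂ}
    (hf : AEStronglyMeasurable f volume) : AEStronglyMeasurable (act a f) volume := by
  induction a using AddMonoidAlgebra.induction_linear with
  | zero => rw [map_zero]; exact aestronglyMeasurable_const
  | add a b ha hb => rw [act_add]; exact ha.add hb
  | single y c =>
    have : act (AddMonoidAlgebra.single y c) f = fun x => c * f (x + y) :=
      funext fun x => act_single y c f x
    rw [this]
    exact (hf.comp_measurePreserving (measurePreserving_add_right volume y)).const_mul c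

/-- `a` acts on `L_p` with norm at most `K`. -/
def Bd {d : ℕ} (p K : ℝ≥0∞) (a : TransAlg d) : Prop :=
  ∀ f : (Fin d → ℝ) → ℂ, AEStronglyMeasurable f volume →
    eLpNorm (act a f) p volume ≤ K * eLpNorm f p volume

theorem bd_single {d : ℕ} (p : ℝ≥0∞) (y : Fin d → ℝ) (c : ℂ) :
    Bd p ‖c‖ₑ (AddMonoidAlgebra.single y c) := by
  intro f hf
  have : act (AddMonoidAlgebra.single y c) f = c • (f ∘ fun x => x + y) :=
    funext fun x => act_single y c f x
  rw [this, eLpNorm_const_smul,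
    eLpNorm_comp_measurePreserving hf (measurePreserving_add_right volume y)]

theorem bd_shift {d : ℕ} (p : ℝ≥0∞) (t : ℝ) (i : Fin d) : Bd p 1 (shift t i) := by
  rw [shift]
  simpa using bd_single p (Pi.single i t) 1

theorem bd_one {d : ℕ} (p : ℝ≥0∞) : Bd p 1 (1 : TransAlg d) := by
  intro f _
  rw [act_one, one_mul]

theorem Bd.mul {d : ℕ} {p K L : ℝ≥0∞} {a b : TransAlg d} (ha : Bd p K a) (hb : Bd p L b) :
    Bd p (K * L) (a * b) := by
  intro f hf
  rw [act_mul, mul_assoc]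
  exact (ha _ (aestronglyMeasurable_act b hf)).trans (by gcongr; exact hb f hf)

theorem Bd.add {d : ℕ} {p K L : ℝ≥0∞} (hp : 1 ≤ p) {a b : TransAlg d} (ha : Bd p K a)
    (hb : Bd p L b) : Bd p (K + L) (a + b) := by
  intro f hf
  rw [act_add, add_mul]
  exact (eLpNorm_add_le (aestronglyMeasurable_act a hf) (aestronglyMeasurable_act b hf) hp).trans
    (add_le_add (ha f hf) (hb f hf))

theorem Bd.sub {d : ℕ} {p K L : ℝ≥0∞} (hp : 1 ≤ p) {a b : TransAlg d} (ha : Bd p K a)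
    (hb : Bd p L b) : Bd p (K + L) (a - b) := by
  intro f hf
  rw [act_sub, add_mul]
  exact (eLpNorm_sub_le (aestronglyMeasurable_act a hf) (aestronglyMeasurable_act b hf) hp).trans
    (add_le_add (ha f hf) (hb f hf))

theorem Bd.smul {d : ℕ} {p K : ℝ≥0∞} {a : TransAlg d} (ha : Bd p K a) (c : ℂ) :
    Bd p (‖c‖ₑ * K) (c • a) := by
  intro f hf
  rw [act_smul, eLpNorm_const_smul, mul_assoc]
  gcongr
  exact ha f hf

theorem Bd.mono {d : ℕ} {p K L : ℝ≥0∞} {a : TransAlg d} (ha : Bd p K a) (h : K ≤ L) :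
    Bd p L a :=
  fun f hf => (ha f hf).trans (by gcongr)

theorem bd_zero {d : ℕ} (p : ℝ≥0∞) : Bd p 0 (0 : TransAlg d) := by
  intro f _
  rw [map_zero]
  simp

theorem bd_sum {d : ℕ} {ι : Type*} {p : ℝ≥0∞} (hp : 1 ≤ p) (s : Finset ι) {a : ι → TransAlg d}
    {K : ι → ℝ≥0∞} (h : ∀ i ∈ s, Bd p (K i) (a i)) : Bd p (∑ i ∈ s, K i) (∑ i ∈ s, a i) := by
  classical
  induction s using Finset.induction_on with
  | empty => simpa using bd_zero p
  | insert i s hi ih =>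
    rw [Finset.sum_insert hi, Finset.sum_insert hi]
    exact (h i (by simp)).add hp (ih fun j hj => h j (by simp [hj]))

theorem bd_prod {d : ℕ} {ι : Type*} {p : ℝ≥0∞} (s : Finset ι) {a : ι → TransAlg d}
    {K : ι → ℝ≥0∞} (h : ∀ i ∈ s, Bd p (K i) (a i)) : Bd p (∏ i ∈ s, K i) (∏ i ∈ s, a i) := by
  classical
  induction s using Finset.induction_on with
  | empty => simpa using bd_one p
  | insert i s hi ih =>
    rw [Finset.prod_insert hi, Finset.prod_insert hi]
    exact (h i (by simp)).mul (ih fun j hj => h j (by simp [hj]))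

theorem Bd.pow {d : ℕ} {p K : ℝ≥0∞} {a : TransAlg d} (ha : Bd p K a) (n : ℕ) :
    Bd p (K ^ n) (a ^ n) := by
  simpa using bd_prod (p := p) (range n) (a := fun _ => a) (K := fun _ => K) fun _ _ => ha

theorem bd_diff {d : ℕ} {p : ℝ≥0∞} (hp : 1 ≤ p) (t : ℝ) (i : Fin d) : Bd p 2 (diff t i) :=
  ((bd_shift p t i).sub hp (bd_one p)).mono (by norm_num)

/-! ### Locality -/

/-- `act a f x` depends only on the values of `f` in the ball of radius `R` around `x`. -/
def IsLocal {d : ℕ} (R : ℝ) (a : TransAlg d) : Prop :=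
  ∀ (f : (Fin d → ℝ) → ℂ) (x : Fin d → ℝ), (∀ y, ‖y - x‖ ≤ R → f y = 0) → act a f x = 0

theorem isLocal_one {d : ℕ} : IsLocal 0 (1 : TransAlg d) := by
  intro f x h
  rw [act_one]
  exact h x (by simp)

theorem IsLocal.mul {d : ℕ} {R S : ℝ} {a b : TransAlg d} (ha : IsLocal R a) (hb : IsLocal S b) :
    IsLocal (R + S) (a * b) := by
  intro f x h
  rw [act_mul]
  refine ha _ x fun y hy => hb _ y fun z hz => h z ?_
  calc ‖z - x‖ = ‖(y - x) + (z - y)‖ := by congr 1; abel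
    _ ≤ ‖y - x‖ + ‖z - y‖ := norm_add_le _ _
    _ ≤ R + S := add_le_add hy hz

theorem isLocal_prod {d : ℕ} {ι : Type*} (s : Finset ι) {a : ι → TransAlg d} {R : ι → ℝ}
    (h : ∀ i ∈ s, IsLocal (R i) (a i)) : IsLocal (∑ i ∈ s, R i) (∏ i ∈ s, a i) := by
  classical
  induction s using Finset.induction_on with
  | empty => simpa using isLocal_one
  | insert i s hi ih =>
    rw [Finset.sum_insert hi, Finset.prod_insert hi]
    exact (h i (by simp)).mul (ih fun j hj => h j (by simp [hj]))

theorem IsLocal.pow {d : ℕ} {R : ℝ} {a : TransAlg d} (ha : IsLocal R a) (n : ℕ) :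
    IsLocal (n * R) (a ^ n) := by
  simpa using isLocal_prod (range n) (a := fun _ => a) (R := fun _ => R) fun _ _ => ha

theorem IsLocal.mono {d : ℕ} {R S : ℝ} {a : TransAlg d} (ha : IsLocal R a) (h : R ≤ S) :
    IsLocal S a :=
  fun f x hf => ha f x fun y hy => hf y (hy.trans h)

theorem isLocal_shift {d : ℕ} (t : ℝ) (i : Fin d) : IsLocal |t| (shift t i) := by
  intro f x h
  rw [act_shift]
  refine h _ ?_
  simp [Pi.norm_single]

theorem isLocal_diff {d : ℕ} (t : ℝ) (i : Fin d) : IsLocal |t| (diff t i) := by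
  intro f x h
  rw [diff, act_sub, act_one, Pi.sub_apply, isLocal_shift t i f x h, h x (by simp), sub_zero]

theorem isLocal_multiDiff {d : ℕ} (n : Fin d → ℕ) (h : Fin d → ℝ) :
    IsLocal (∑ i, n i * |h i|) (multiDiff n h) :=
  isLocal_prod _ fun i _ => (isLocal_diff (h i) i).pow (n i)

/-! ### Joint measurability -/

/-- A family `v ↦ a v` acting jointly measurably. -/
def MeasFam {d : ℕ} (a : (Fin d → ℝ) → TransAlg d) : Prop :=
  ∀ F : (Fin d → ℝ) → (Fin d → ℝ) → ℂ, Measurable (Function.uncurry F) →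
    Measurable (Function.uncurry fun v x => act (a v) (F v) x)

theorem measFam_diff {d : ℕ} (i : Fin d) : MeasFam fun v => diff (v i) i := by
  intro F hF
  have : (Function.uncurry fun v x => act (diff (v i) i) (F v) x) = fun z =>
      Function.uncurry F (z.1, z.2 + Pi.single i (z.1 i)) - Function.uncurry F z :=
    funext fun z => act_diff _ _ _ _
  rw [this]
  refine (hF.comp ?_).sub hF
  refine measurable_fst.prodMk (measurable_snd.add ?_)
  refine measurable_pi_lambda _ fun j => ?_
  by_cases hj : j = i
  · subst hj
    simp only [Pi.single_eq_same]
    exact (measurable_pi_apply j).comp measurable_fst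
  · simp [Pi.single_eq_of_ne hj]

theorem MeasFam.mul {d : ℕ} {a b : (Fin d → ℝ) → TransAlg d} (ha : MeasFam a) (hb : MeasFam b) :
    MeasFam fun v => a v * b v := by
  intro F hF
  simp only [act_mul]
  exact ha (fun v => act (b v) (F v)) (hb F hF)

theorem measFam_prod {d : ℕ} {ι : Type*} (s : Finset ι) {a : ι → (Fin d → ℝ) → TransAlg d}
    (h : ∀ i ∈ s, MeasFam (a i)) : MeasFam fun v => ∏ i ∈ s, a i v := by
  classical
  induction s using Finset.induction_on with
  | empty =>
    intro F hF
    simpa only [Finset.prod_empty, act_one] using hF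
  | insert i s hi ih =>
    simp only [Finset.prod_insert hi]
    exact (h i (by simp)).mul (ih fun j hj => h j (by simp [hj]))

theorem measFam_multiDiff {d : ℕ} (n : Fin d → ℕ) : MeasFam fun v => multiDiff n v := by
  refine measFam_prod _ fun i _ => ?_
  simpa using measFam_prod (range (n i)) (a := fun _ v => diff (v i) i) fun _ _ => measFam_diff i

/-! ### The functional `lpSum` -/

theorem toReal_pos_of_one_le {p : ℝ≥0∞} (hp : 1 ≤ p) (h : p ≠ ⊤) : 0 < p.toReal :=
  ENNReal.toReal_pos (by rintro rfl; simp at hp) h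

theorem one_le_toReal {p : ℝ≥0∞} (hp : 1 ≤ p) (h : p ≠ ⊤) : 1 ≤ p.toReal := by
  simpa using ENNReal.toReal_mono h hp

theorem lpSum_top {ι : Type*} (a : ι → ℝ≥0∞) : lpSum ⊤ a = ⨆ i, a i := by simp [lpSum]

theorem lpSum_of_ne_top {ι : Type*} {p : ℝ≥0∞} (h : p ≠ ⊤) (a : ι → ℝ≥0∞) :
    lpSum p a = (∑' i, a i ^ p.toReal) ^ (1 / p.toReal) := by simp [lpSum, h]

theorem lpSum_rpow {ι : Type*} {p : ℝ≥0∞} (hp : 1 ≤ p) (h : p ≠ ⊤) (a : ι → ℝ≥0∞) :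
    lpSum p a ^ p.toReal = ∑' i, a i ^ p.toReal := by
  rw [lpSum_of_ne_top h, ← ENNReal.rpow_mul, one_div_mul_cancel (toReal_pos_of_one_le hp h).ne',
    ENNReal.rpow_one]

theorem lpSum_le_iff {ι : Type*} {p : ℝ≥0∞} (hp : 1 ≤ p) (h : p ≠ ⊤) (a : ι → ℝ≥0∞)
    (b : ℝ≥0∞) : lpSum p a ≤ b ↔ ∑' i, a i ^ p.toReal ≤ b ^ p.toReal := by
  rw [← lpSum_rpow hp h, ENNReal.rpow_le_rpow_iff (toReal_pos_of_one_le hp h)]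

theorem lpSum_mono {ι : Type*} {p : ℝ≥0∞} {a b : ι → ℝ≥0∞} (h : ∀ i, a i ≤ b i) :
    lpSum p a ≤ lpSum p b := by
  unfold lpSum
  split_ifs
  · exact iSup_mono h
  · refine ENNReal.rpow_le_rpow (ENNReal.tsum_le_tsum fun i => ?_) (by positivity)
    exact ENNReal.rpow_le_rpow (h i) (by positivity)

theorem le_lpSum {ι : Type*} {p : ℝ≥0∞} (hp : 1 ≤ p) (a : ι → ℝ≥0∞) (i : ι) :
    a i ≤ lpSum p a := by
  by_cases h : p = ⊤
  · subst h; rw [lpSum_top]; exact le_iSup a i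
  · rw [← ENNReal.rpow_le_rpow_iff (toReal_pos_of_one_le hp h), lpSum_rpow hp h]
    exact ENNReal.le_tsum i

theorem lpSum_zero {ι : Type*} {p : ℝ≥0∞} (hp : 1 ≤ p) : lpSum p (fun _ : ι => 0) = 0 := by
  by_cases h : p = ⊤
  · subst h; simp [lpSum_top]
  · have := toReal_pos_of_one_le hp h
    simp [lpSum_of_ne_top h, this]

theorem lpSum_const_mul {ι : Type*} {p : ℝ≥0∞} (hp : 1 ≤ p) (c : ℝ≥0∞) (a : ι → ℝ≥0∞) :
    lpSum p (fun i => c * a i) = c * lpSum p a := by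
  by_cases h : p = ⊤
  · subst h; simp only [lpSum_top, ENNReal.mul_iSup]
  · have h0 := toReal_pos_of_one_le hp h
    simp only [lpSum_of_ne_top h, ENNReal.mul_rpow_of_nonneg _ _ h0.le]
    rw [ENNReal.tsum_mul_left, ENNReal.mul_rpow_of_nonneg _ _ (by positivity),
      ← ENNReal.rpow_mul, mul_one_div_cancel h0.ne', ENNReal.rpow_one]

theorem lpSum_add_le {ι : Type*} {p : ℝ≥0∞} (hp : 1 ≤ p) (a b : ι → ℝ≥0∞) :
    lpSum p (fun i => a i + b i) ≤ lpSum p a + lpSum p b := by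
  by_cases h : p = ⊤
  · subst h
    simp only [lpSum_top]
    exact iSup_le fun i => add_le_add (le_iSup a i) (le_iSup b i)
  · let _ : MeasurableSpace ι := ⊤
    have := ENNReal.lintegral_Lp_add_le (μ := Measure.count) (f := a) (g := b)
      measurable_from_top.aemeasurable measurable_from_top.aemeasurable (one_le_toReal hp h)
    simpa only [lintegral_count, ← lpSum_of_ne_top h, Pi.add_apply] using this

theorem lpSum_sum_le {ι κ : Type*} {p : ℝ≥0∞} (hp : 1 ≤ p) (s : Finset κ)
    (a : κ → ι → ℝ≥0∞) : lpSum p (fun i => ∑ j ∈ s, a j i) ≤ ∑ j ∈ s, lpSum p (a j) := by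
  classical
  induction s using Finset.induction_on with
  | empty => simp [lpSum_zero hp]
  | insert j s hj ih =>
    simp only [Finset.sum_insert hj]
    exact (lpSum_add_le hp _ _).trans (by gcongr)

theorem lpSum_comm {ι κ : Type*} {p : ℝ≥0∞} (hp : 1 ≤ p) (a : ι → κ → ℝ≥0∞) :
    lpSum p (fun i => lpSum p (a i)) = lpSum p fun j => lpSum p fun i => a i j := by
  by_cases h : p = ⊤
  · subst h; simp only [lpSum_top]; exact iSup_comm
  · rw [lpSum_of_ne_top h, lpSum_of_ne_top h]
    simp only [lpSum_rpow hp h]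
    rw [ENNReal.tsum_comm]

theorem lpSum_extend {ι κ : Type*} {p : ℝ≥0∞} (hp : 1 ≤ p) {g : κ → ι}
    (hg : Function.Injective g) (a : κ → ℝ≥0∞) :
    lpSum p (Function.extend g a 0) = lpSum p a := by
  by_cases h : p = ⊤
  · subst h
    simp only [lpSum_top]
    refine le_antisymm (iSup_le fun i => ?_) (iSup_le fun j => ?_)
    · by_cases hi : ∃ j, g j = i
      · obtain ⟨j, rfl⟩ := hi
        rw [hg.extend_apply]
        exact le_iSup a j
      · simp [Function.extend_apply' _ _ _ hi]
    · refine le_iSup_of_le (g j) ?_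
      rw [hg.extend_apply]
  · have h0 := toReal_pos_of_one_le hp h
    rw [lpSum_of_ne_top h, lpSum_of_ne_top h, ← hg.tsum_eq]
    · simp only [hg.extend_apply]
    · intro i hi
      by_contra hn
      refine hi ?_
      have : ¬∃ j, g j = i := hn
      simp [Function.extend_apply' _ _ _ this, h0]

/-- Every finite subfamily lies below some level. Truncation allows an induction on the level
without knowing beforehand that `lpSum p a` is finite. -/
theorem lpSum_le_of_truncated {ι : Type*} {p : ℝ≥0∞} (hp : 1 ≤ p) (lev : ι → ℕ)
    (a : ι → ℝ≥0∞) {b : ℝ≥0∞}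
    (h : ∀ N, lpSum p (fun k => if lev k ≤ N then a k else 0) ≤ b) : lpSum p a ≤ b := by
  by_cases hpt : p = ⊤
  · subst hpt
    simp only [lpSum_top] at h ⊢
    refine iSup_le fun k => le_trans ?_ (h (lev k))
    refine le_iSup_of_le k ?_
    simp
  · rw [lpSum_le_iff hp hpt]
    rw [ENNReal.tsum_eq_iSup_sum]
    refine iSup_le fun s => ?_
    have := (lpSum_le_iff hp hpt _ _).1 (h (s.sup lev))
    refine le_trans ?_ this
    refine le_trans (le_of_eq ?_) (ENNReal.sum_le_tsum s)
    refine Finset.sum_congr rfl fun k hk => ?_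
    rw [if_pos (Finset.le_sup hk)]

/-- A discrete Hardy type inequality: a family with `a (succ k) ≤ c (succ k) + θ a k`, `θ < 1`,
is controlled by `c`. -/
theorem lpSum_le_of_recursion {ι : Type*} {p : ℝ≥0∞} (hp : 1 ≤ p) {lev : ι → ℕ} {succ : ι → ι}
    (hinj : Function.Injective succ) (hlev : ∀ k, lev (succ k) = lev k + 1)
    (hsucc : ∀ k, lev k ≠ 0 → ∃ k', succ k' = k) {a c : ι → ℝ≥0∞} {θ : ℝ≥0∞} (hθ : θ < 1)
    (h0 : ∀ k, lev k = 0 → a k ≤ c k) (h1 : ∀ k, a (succ k) ≤ c (succ k) + θ * a k) :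
    lpSum p a ≤ (1 - θ)⁻¹ * lpSum p c := by
  -- The claimed bound is the fixed point of `X ↦ lpSum p c + θ * X`. It therefore survives each
  -- step of an induction on the truncation level, and no infinite quantity has to be absorbed.
  refine lpSum_le_of_truncated hp lev a fun N => ?_
  have hX : lpSum p c + θ * ((1 - θ)⁻¹ * lpSum p c) = (1 - θ)⁻¹ * lpSum p c := by
    have h2 : (1 - θ) ≠ 0 := (tsub_pos_of_lt hθ).ne'
    have h3 : (1 - θ) ≠ ⊤ := ne_top_of_le_ne_top ENNReal.one_ne_top tsub_le_self
    calc lpSum p c + θ * ((1 - θ)⁻¹ * lpSum p c)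
        = ((1 - θ) * (1 - θ)⁻¹) * lpSum p c + θ * ((1 - θ)⁻¹ * lpSum p c) := by
          rw [ENNReal.mul_inv_cancel h2 h3, one_mul]
      _ = ((1 - θ) + θ) * ((1 - θ)⁻¹ * lpSum p c) := by ring
      _ = (1 - θ)⁻¹ * lpSum p c := by rw [tsub_add_cancel_of_le hθ.le, one_mul]
  induction N with
  | zero =>
    refine le_trans (lpSum_mono (b := c) fun k => ?_) (le_trans le_self_add hX.le)
    split_ifs with hk
    · exact h0 k (by omega)
    · exact zero_le
  | succ N ih =>
    have hstep : ∀ k, (if lev k ≤ N + 1 then a k else 0) ≤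
        c k + θ * Function.extend succ (fun k => if lev k ≤ N then a k else 0) 0 k := by
      intro k
      split_ifs with hk
      · by_cases hz : lev k = 0
        · exact (h0 k hz).trans le_self_add
        · obtain ⟨k', rfl⟩ := hsucc k hz
          rw [hinj.extend_apply, if_pos (by rw [hlev] at hk; omega)]
          exact h1 k'
      · exact zero_le
    refine (lpSum_mono hstep).trans ((lpSum_add_le hp _ _).trans ?_)
    rw [lpSum_const_mul hp, lpSum_extend hp hinj]
    refine le_trans ?_ hX.le
    gcongr

/-! ### Sums of functions with finite overlap -/

/-- A locally finite sum is controlled in `L_p` by the `ℓ_p` sum of the norms. -/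
theorem eLpNorm_le_lpSum_of_overlap {α ι E : Type*} [MeasurableSpace α] {ν : Measure α}
    [Countable ι] [NormedAddCommGroup E] {p : ℝ≥0∞} (hp : 1 ≤ p) {N : ℕ} {F : α → E}
    {G : ι → α → E} (hG : ∀ i, AEStronglyMeasurable (G i) ν) (S : α → Finset ι)
    (hS : ∀ x, #(S x) ≤ N) (hF : ∀ x, F x = ∑ i ∈ S x, G i x) :
    eLpNorm F p ν ≤ N * lpSum p fun i => eLpNorm (G i) p ν := by
  have hpt : ∀ x, ∀ B : ℝ≥0∞, (∀ i, ‖G i x‖ₑ ≤ B) → ‖F x‖ₑ ≤ N * B := fun x B hB => by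
    rw [hF x]
    calc ‖∑ i ∈ S x, G i x‖ₑ ≤ ∑ i ∈ S x, ‖G i x‖ₑ := enorm_sum_le _ _
      _ ≤ ∑ i ∈ S x, B := Finset.sum_le_sum fun i _ => hB i
      _ = #(S x) * B := by simp
      _ ≤ N * B := by gcongr; exact hS x
  by_cases h : p = ⊤
  · subst h
    rw [lpSum_top, eLpNorm_exponent_top]
    refine essSup_le_of_ae_le _ ?_
    have : ∀ᵐ x ∂ν, ∀ i, ‖G i x‖ₑ ≤ eLpNormEssSup (G i) ν :=
      ae_all_iff.2 fun i => ae_le_eLpNormEssSup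
    filter_upwards [this] with x hx
    refine hpt x _ fun i => (hx i).trans ?_
    exact le_iSup (fun i => eLpNorm (G i) ⊤ ν) i
  · have h0 := toReal_pos_of_one_le hp h
    have hp0 : p ≠ 0 := by rintro rfl; simp at hp
    rw [← ENNReal.rpow_le_rpow_iff h0, ENNReal.mul_rpow_of_nonneg _ _ h0.le, lpSum_rpow hp h]
    simp only [eLpNorm_eq_lintegral_rpow_enorm_toReal hp0 h, ← ENNReal.rpow_mul,
      one_div_mul_cancel h0.ne', ENNReal.rpow_one]
    rw [← lintegral_tsum fun i => (hG i).enorm.pow_const _, ← lintegral_const_mul'' _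
      (AEMeasurable.tsum fun i => (hG i).enorm.pow_const _)]
    refine lintegral_mono fun x => ?_
    -- Each summand is at most the pointwise `ℓ_p` norm of the whole family, so `F` is at most `N`
    -- times that norm. Tonelli's theorem then gives the integrated form.
    have := hpt x ((∑' i, ‖G i x‖ₑ ^ p.toReal) ^ (1 / p.toReal)) fun i => by
      rw [← ENNReal.rpow_le_rpow_iff h0, ← ENNReal.rpow_mul, one_div_mul_cancel h0.ne',
        ENNReal.rpow_one]
      exact ENNReal.le_tsum i
    refine (ENNReal.rpow_le_rpow this h0.le).trans (le_of_eq ?_)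
    rw [ENNReal.mul_rpow_of_nonneg _ _ h0.le, ← ENNReal.rpow_mul, one_div_mul_cancel h0.ne',
        ENNReal.rpow_one]

/-- The `ℓ_p` sum of the norms of functions with finite overlap dominated by `G`. -/
theorem lpSum_eLpNorm_le_of_overlap {α ι E : Type*} [MeasurableSpace α] {ν : Measure α}
    [Countable ι] [NormedAddCommGroup E] {p : ℝ≥0∞} (hp : 1 ≤ p) {N : ℕ} (hN : 1 ≤ N)
    {F : ι → α → E} (hF : ∀ i, AEStronglyMeasurable (F i) ν) {G : α → ℝ} (S : α → Finset ι)
    (hS : ∀ x, #(S x) ≤ N) (hzero : ∀ i x, i ∉ S x → F i x = 0)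
    (hle : ∀ i x, ‖F i x‖ ≤ G x) :
    (lpSum p fun i => eLpNorm (F i) p ν) ≤ N * eLpNorm G p ν := by
  have hle' : ∀ i x, ‖F i x‖ₑ ≤ ‖G x‖ₑ := fun i x =>
    enorm_le_iff_norm_le.2 ((hle i x).trans (le_abs_self _))
  have hN' : (1 : ℝ≥0∞) ≤ N := by exact_mod_cast hN
  by_cases h : p = ⊤
  · subst h
    rw [lpSum_top]
    refine iSup_le fun i => le_trans ?_ (le_mul_of_one_le_left zero_le hN')
    exact eLpNorm_mono_real (hle i)
  · have h0 := toReal_pos_of_one_le hp h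
    have hp0 : p ≠ 0 := by rintro rfl; simp at hp
    rw [lpSum_le_iff hp h, ENNReal.mul_rpow_of_nonneg _ _ h0.le]
    simp only [eLpNorm_eq_lintegral_rpow_enorm_toReal hp0 h, ← ENNReal.rpow_mul,
      one_div_mul_cancel h0.ne', ENNReal.rpow_one]
    rw [← lintegral_tsum fun i => (hF i).enorm.pow_const _, ← lintegral_const_mul' _ _
      (by simp [h0.le])]
    refine lintegral_mono fun x => ?_
    rw [tsum_eq_sum (s := S x) fun i hi => by simp [hzero i x hi, h0]]
    calc ∑ i ∈ S x, ‖F i x‖ₑ ^ p.toReal ≤ ∑ i ∈ S x, ‖G x‖ₑ ^ p.toReal :=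
          Finset.sum_le_sum fun i _ => ENNReal.rpow_le_rpow (hle' i x) h0.le
      _ = #(S x) * ‖G x‖ₑ ^ p.toReal := by simp
      _ ≤ N ^ p.toReal * ‖G x‖ₑ ^ p.toReal := by
          gcongr
          calc ((#(S x) : ℕ) : ℝ≥0∞) ≤ N := by exact_mod_cast hS x
            _ = (N : ℝ≥0∞) ^ (1 : ℝ) := by simp
            _ ≤ (N : ℝ≥0∞) ^ p.toReal :=
              ENNReal.rpow_le_rpow_of_exponent_le hN' (one_le_toReal hp h)

/-! ### Moduli of arbitrary order and averaging -/

/-- The modulus of smoothness of order `n i` in direction `i`. -/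
noncomputable def orderModulus {d : ℕ} (n : Fin d → ℕ) (p : ℝ≥0∞) (f : (Fin d → ℝ) → ℂ)
    (t : Fin d → ℝ) : ℝ≥0∞ :=
  ⨆ (h : Fin d → ℝ) (_ : ∀ i, |h i| < t i), eLpNorm (act (multiDiff n h) f) p volume

theorem modulus_eq_orderModulus {d : ℕ} (m : ℕ) (e : Finset (Fin d)) (p : ℝ≥0∞)
    (f : (Fin d → ℝ) → ℂ) {t : Fin d → ℝ} (ht : ∀ i, 0 < t i) :
    modulus m e p f t = orderModulus (constOrder m e) p f t := by
  classical
  simp only [modulus, orderModulus, mixedDiff_eq_act]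
  refine le_antisymm (iSup₂_le fun h hh => ?_) (iSup₂_le fun h hh => ?_)
  -- Steps in directions outside `e` do not enter the product. They may be set to 0, which is
  -- admissible because `t i > 0`.
  · have : multiDiff (constOrder m e) h
        = multiDiff (constOrder m e) fun i => if i ∈ e then h i else 0 := by
      simp only [multiDiff_constOrder]
      exact Finset.prod_congr rfl fun i hi => by rw [if_pos hi]
    rw [this]
    refine le_iSup₂_of_le _ (fun i => ?_) le_rfl
    split_ifs with hi
    · exact hh i hi
    · simpa using ht i
  · exact le_iSup₂_of_le h (fun i _ => hh i) le_rfl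

theorem eLpNorm_le_orderModulus {d : ℕ} (n : Fin d → ℕ) (p : ℝ≥0∞) (f : (Fin d → ℝ) → ℂ)
    {t h : Fin d → ℝ} (hh : ∀ i, |h i| < t i) :
    eLpNorm (act (multiDiff n h) f) p volume ≤ orderModulus n p f t :=
  le_iSup₂ (f := fun (h : Fin d → ℝ) (_ : ∀ i, |h i| < t i) =>
    eLpNorm (act (multiDiff n h) f) p volume) h hh

/-- Expanding both inner powers by the binomial theorem gives the same double sum. The monomial `x ^
l * y ^ (j * l)` carries matching coefficients because `j + (m - l)` and `l + (m - j)` have the same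
parity. -/
theorem sum_alternating_mul_pow_sub_one {R : Type*} [CommRing R] (x y : R) (m : ℕ) :
    ∑ j ∈ range (m + 1), (-1) ^ j * (m.choose j : R) * (x * y ^ j - 1) ^ m =
      ∑ l ∈ range (m + 1), (-1) ^ l * (m.choose l : R) * (x ^ l * (y ^ l - 1) ^ m) := by
  have key : ∀ z : R, (z - 1) ^ m =
      ∑ l ∈ range (m + 1), z ^ l * (-1) ^ (m - l) * (m.choose l : R) := fun z => by
    rw [sub_eq_add_neg, add_pow]
  simp only [key, Finset.mul_sum]
  rw [Finset.sum_comm]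
  refine Finset.sum_congr rfl fun l hl => Finset.sum_congr rfl fun j hj => ?_
  have hs : (-1 : R) ^ j * (-1) ^ (m - l) = (-1) ^ l * (-1) ^ (m - j) := by
    rw [← pow_add, ← pow_add]
    refine neg_one_pow_congr ?_
    rw [Finset.mem_range] at hl hj
    rw [Nat.even_iff, Nat.even_iff]
    omega
  calc (-1 : R) ^ j * (m.choose j) * ((x * y ^ j) ^ l * (-1) ^ (m - l) * (m.choose l))
      = ((-1) ^ j * (-1) ^ (m - l)) * ((m.choose j) * (m.choose l) * x ^ l * (y ^ j) ^ l) := by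
        rw [mul_pow]; ring
    _ = ((-1) ^ l * (-1) ^ (m - j)) * ((m.choose j) * (m.choose l) * x ^ l * (y ^ l) ^ j) := by
        rw [hs, ← pow_mul, ← pow_mul, mul_comm j l]
    _ = _ := by ring

/-- The preceding identity is solved for its term `j = 0`; the term `l = 0` on the other side
vanishes. With `x`, `y` the shifts by `t`, `u`, every difference on the right has step `l u` or `t +
j u` with `l, j ≥ 1`, so each moves with the free parameter `u`. -/
theorem sub_one_pow_eq_sum {R : Type*} [CommRing R] (x y : R) {m : ℕ} (hm : 0 < m) :
    (x - 1) ^ m = ∑ j ∈ range m, ((-1) ^ (j + 1) * (m.choose (j + 1) : R) *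
        (x ^ (j + 1) * (y ^ (j + 1) - 1) ^ m) -
      (-1) ^ (j + 1) * (m.choose (j + 1) : R) * (x * y ^ (j + 1) - 1) ^ m) := by
  have h := sum_alternating_mul_pow_sub_one x y m
  rw [Finset.sum_range_succ', Finset.sum_range_succ' (n := m)] at h
  simp only [pow_zero, mul_one, Nat.choose_zero_right, Nat.cast_one, one_mul, sub_self,
    zero_pow hm.ne', add_zero] at h
  rw [Finset.sum_sub_distrib, ← h]
  ring

/-- The step occurring in the averaged representation of a difference. -/
def avgStep {m : ℕ} (α : Bool × Fin m) (t u : ℝ) : ℝ :=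
  (if α.1 then t else 0) + ((α.2 : ℕ) + 1 : ℕ) * u

theorem exists_diff_pow_eq_sum {d m : ℕ} (hm : 0 < m) {p : ℝ≥0∞} (n : ℕ) (hn : n = m ∨ n = 0)
    (t u : ℝ) (i : Fin d) : ∃ E : Bool × Fin m → TransAlg d, (∀ α, Bd p (2 ^ m) (E α)) ∧
      diff t i ^ n = ∑ α, E α * diff (avgStep α t u) i ^ n := by
  classical
  have h2 : (1 : ℝ≥0∞) ≤ 2 ^ m := one_le_pow₀ (by norm_num)
  rcases hn with rfl | rfl
  · have hc : ∀ j : Fin n, ‖((-1 : ℂ) ^ ((j : ℕ) + 1) * (n.choose (j + 1) : ℂ))‖ₑ ≤ 2 ^ n := by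
      intro j
      rw [enorm_mul, enorm_pow]
      have : (n.choose (j + 1) : ℂ) = ((n.choose (j + 1) : ℕ) : ℝ) := by simp
      simp only [enorm_neg, enorm_one, one_pow, one_mul]
      rw [← ofReal_norm, Complex.norm_natCast, ENNReal.ofReal_natCast]
      exact_mod_cast Nat.choose_le_two_pow n (j + 1)
    refine ⟨fun α => if α.1
      then (-((-1 : ℂ) ^ ((α.2 : ℕ) + 1) * (n.choose (α.2 + 1) : ℂ))) • (1 : TransAlg d)
      else ((-1 : ℂ) ^ ((α.2 : ℕ) + 1) * (n.choose (α.2 + 1) : ℂ)) • shift ((α.2 + 1 : ℕ) * t) i,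
      fun α => ?_, ?_⟩
    · dsimp only
      split_ifs
      · refine ((bd_one p).smul _).mono ?_
        rw [enorm_neg, mul_one]
        exact hc _
      · refine ((bd_shift p _ i).smul _).mono ?_
        rw [mul_one]
        exact hc _
    · rw [Fintype.sum_prod_type]
      simp only [Fintype.sum_bool, if_true, avgStep, Bool.false_eq_true, if_false, zero_add]
      rw [← Finset.sum_add_distrib]
      rw [diff, sub_one_pow_eq_sum (shift t i) (shift u i) hm, Finset.sum_range]
      refine Finset.sum_congr rfl fun j _ => ?_
      simp only [diff, shift_add, shift_nat_mul, Algebra.smul_def, map_mul, map_pow, map_neg,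
        map_one, map_natCast]
      ring
  -- For order 0 both sides are the identity. A single coefficient 1 keeps the index set the same in
  -- all directions.
  · refine ⟨fun α => if α = (false, ⟨0, hm⟩) then 1 else 0, fun α => ?_, ?_⟩
    · dsimp only
      split_ifs
      · exact (bd_one p).mono h2
      · exact (bd_zero p).mono zero_le
    · simp

/-- The one-dimensional representations are multiplied over all directions and the product of sums
is expanded. The coefficients together have operator norm at most `(2 ^ m) ^ d`. -/
theorem eLpNorm_multiDiff_le_sum {d m : ℕ} (hm : 0 < m) {p : ℝ≥0∞} (hp : 1 ≤ p)
    {n : Fin d → ℕ} (hn : ∀ i, n i = m ∨ n i = 0) (h u : Fin d → ℝ) {g : (Fin d → ℝ) → ℂ}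
    (hg : AEStronglyMeasurable g volume) :
    eLpNorm (act (multiDiff n h) g) p volume ≤ (2 ^ m) ^ d * ∑ α : Fin d → Bool × Fin m,
      eLpNorm (act (multiDiff n fun i => avgStep (α i) (h i) (u i)) g) p volume := by
  classical
  choose E hE hsum using fun i => exists_diff_pow_eq_sum (d := d) hm (p := p) (n i) (hn i)
    (h i) (u i) i
  have : multiDiff n h = ∑ α : Fin d → Bool × Fin m,
      (∏ i, E i (α i)) * multiDiff n fun i => avgStep (α i) (h i) (u i) := by
    simp only [multiDiff, hsum, ← Finset.prod_mul_distrib]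
    rw [Finset.prod_univ_sum]
    simp
  rw [this, act_sum, Finset.mul_sum]
  refine (eLpNorm_sum_le (fun α _ => aestronglyMeasurable_act _ hg) hp).trans ?_
  refine Finset.sum_le_sum fun α _ => ?_
  rw [act_mul]
  have := bd_prod (p := p) univ (a := fun i => E i (α i)) (K := fun _ => 2 ^ m)
    fun i _ => hE i (α i)
  simp only [Finset.prod_const, Finset.card_univ, Fintype.card_fin] at this
  exact this _ (aestronglyMeasurable_act _ hg)

theorem act_congr_ae {d : ℕ} {f g : (Fin d → ℝ) → ℂ} (hfg : f =ᵐ[volume] g)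
    (a : TransAlg d) : act a f =ᵐ[volume] act a g := by
  induction a using AddMonoidAlgebra.induction_linear with
  | zero => rw [map_zero]; rfl
  | add a b ha hb => rw [act_add, act_add]; exact ha.add hb
  | single y c =>
    have h := (measurePreserving_add_right volume y).quasiMeasurePreserving.ae_eq_comp hfg
    filter_upwards [h] with x hx
    rw [act_single, act_single]
    congr 1

/-- Joint measurability in step and point needs a Borel function, so `g` is replaced by a measurable
representative, which changes none of the norms. -/
theorem measurable_eLpNorm_multiDiff {d : ℕ} {p : ℝ≥0∞} (hp : 1 ≤ p) (hpt : p ≠ ⊤)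
    (n : Fin d → ℕ) {g : (Fin d → ℝ) → ℂ} (hg : AEStronglyMeasurable g volume) :
    Measurable fun v => eLpNorm (act (multiDiff n v) g) p volume := by
  have hp0 : p ≠ 0 := by rintro rfl; simp at hp
  have h1 : ∀ v, eLpNorm (act (multiDiff n v) g) p volume
      = eLpNorm (act (multiDiff n v) (hg.mk g)) p volume := fun v =>
    eLpNorm_congr_ae (act_congr_ae hg.ae_eq_mk _)
  simp only [h1, eLpNorm_eq_lintegral_rpow_enorm_toReal hp0 hpt]
  refine Measurable.pow_const ?_ _
  have h2 := measFam_multiDiff n (fun _ => hg.mk g)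
    (hg.stronglyMeasurable_mk.measurable.comp measurable_snd)
  exact Measurable.lintegral_prod_right' (h2.enorm.pow_const _)

/-- The box `∏ (-t_i, t_i)`. -/
def box {d : ℕ} (t : Fin d → ℝ) : Set (Fin d → ℝ) := Set.pi Set.univ fun i => Set.Ioo (-t i) (t i)

theorem mem_box {d : ℕ} {t v : Fin d → ℝ} : v ∈ box t ↔ ∀ i, |v i| < t i := by
  simp [box, abs_lt]

theorem volume_box {d : ℕ} (t : Fin d → ℝ) :
    volume (box t) = ∏ i, ENNReal.ofReal (2 * t i) := by
  rw [box, Real.volume_pi_Ioo]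
  congr 1
  ext i
  congr 1
  ring

theorem measurableSet_box {d : ℕ} (t : Fin d → ℝ) : MeasurableSet (box t) :=
  MeasurableSet.univ_pi fun _ => measurableSet_Ioo

/-- An affine change of variables whose Jacobian determinant is at least 1. -/
theorem lintegral_comp_diagonal_le {d : ℕ} {Φ : (Fin d → ℝ) → ℝ≥0∞} (hΦ : Measurable Φ)
    {D : Fin d → ℝ} (hD : ∀ i, 1 ≤ D i) (b : Fin d → ℝ) :
    ∫⁻ u : Fin d → ℝ, Φ (b + fun i => D i * u i) ≤ ∫⁻ v, Φ v := by
  have hdet : (1 : ℝ) ≤ (Matrix.diagonal D).det := by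
    rw [Matrix.det_diagonal]
    simpa using Finset.prod_le_prod (s := univ) (f := fun _ : Fin d => (1 : ℝ))
      (fun _ _ => zero_le_one) fun i _ => hD i
  have hmap := Real.smul_map_diagonal_volume_pi (D := D) (by linarith)
  have hlin : ∀ u : Fin d → ℝ, (Matrix.toLin' (Matrix.diagonal D)) u = fun i => D i * u i := by
    intro u
    ext i
    simp [Matrix.mulVec_diagonal]
  have hmeas : Measurable (Matrix.toLin' (Matrix.diagonal D) : (Fin d → ℝ) → Fin d → ℝ) := by
    have : (Matrix.toLin' (Matrix.diagonal D) : (Fin d → ℝ) → Fin d → ℝ)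
        = fun u i => D i * u i := funext hlin
    rw [this]
    fun_prop
  calc ∫⁻ u : Fin d → ℝ, Φ (b + fun i => D i * u i)
      = ∫⁻ v, Φ (b + v) ∂(Measure.map (Matrix.toLin' (Matrix.diagonal D)) volume) := by
        rw [lintegral_map (f := fun v => Φ (b + v)) (hΦ.comp (measurable_const_add b)) hmeas]
        simp only [hlin]
    _ ≤ ENNReal.ofReal |(Matrix.diagonal D).det| *
        ∫⁻ v, Φ (b + v) ∂(Measure.map (Matrix.toLin' (Matrix.diagonal D)) volume) :=
        le_mul_of_one_le_left zero_le
          (by rw [ENNReal.one_le_ofReal]; exact hdet.trans (le_abs_self _))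
    _ = ∫⁻ v, Φ (b + v) := by rw [← smul_eq_mul, ← lintegral_smul_measure, hmap]
    _ = ∫⁻ v, Φ v := lintegral_add_left_eq_self Φ b

theorem avgStep_abs_lt {m : ℕ} (α : Bool × Fin m) {t u s : ℝ} (ht : |t| < s) (hu : |u| < s) :
    |avgStep α t u| < (m + 1) * s := by
  have h0 : 0 < s := (abs_nonneg t).trans_lt ht
  have h1 : |if α.1 then t else 0| < s := by split_ifs <;> simp [ht, h0]
  have h2 : |(((α.2 : ℕ) + 1 : ℕ) : ℝ) * u| ≤ m * s := by
    rw [abs_mul, Nat.abs_cast]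
    gcongr
    exact_mod_cast α.2.2
  calc |avgStep α t u| ≤ _ + _ := abs_add_le _ _
    _ < s + m * s := add_lt_add_of_lt_of_le h1 h2
    _ = _ := by ring

/-- The modulus is controlled by an integral mean of differences. -/
theorem orderModulus_rpow_mul_volume_le {d m : ℕ} (hm : 0 < m) {p : ℝ≥0∞} (hp : 1 ≤ p)
    (hpt : p ≠ ⊤) {n : Fin d → ℕ} (hn : ∀ i, n i = m ∨ n i = 0) {g : (Fin d → ℝ) → ℂ}
    (hg : AEStronglyMeasurable g volume) (t : Fin d → ℝ) :
    orderModulus n p g t ^ p.toReal * volume (box t) ≤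
      ((2 ^ m) ^ d) ^ p.toReal * (((2 * m) ^ d : ℕ) : ℝ≥0∞) ^ p.toReal *
        ∫⁻ v in box (fun i => (m + 1) * t i), eLpNorm (act (multiDiff n v) g) p volume ^ p.toReal := by
  classical
  set q := p.toReal
  have hq : 0 < q := toReal_pos_of_one_le hp hpt
  have hq1 : 1 ≤ q := one_le_toReal hp hpt
  set W := box (fun i => (m + 1) * t i)
  set G : (Fin d → ℝ) → ℝ≥0∞ := fun v => eLpNorm (act (multiDiff n v) g) p volume ^ q with hGdef
  have hG : Measurable G := (measurable_eLpNorm_multiDiff hp hpt n hg).pow_const _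
  have hcard : (#(univ : Finset (Fin d → Bool × Fin m))) = (2 * m) ^ d := by simp
  set X := ((2 ^ m) ^ d) ^ q * (((2 * m) ^ d : ℕ) : ℝ≥0∞) ^ q * ∫⁻ v in W, G v with hX
  have hpoint : ∀ h, (∀ i, |h i| < t i) →
      eLpNorm (act (multiDiff n h) g) p volume ^ q * volume (box t) ≤ X := by
    intro h hh
    set Φ := W.indicator G with hΦ
    have hΦm : Measurable Φ := hG.indicator (measurableSet_box _)
    set st : (Fin d → Bool × Fin m) → (Fin d → ℝ) → Fin d → ℝ :=
      fun α u i => avgStep (α i) (h i) (u i) with hst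
    have hst' : ∀ α u, st α u = (fun i => if (α i).1 then h i else 0) +
        fun i => ((((α i).2 : ℕ) + 1 : ℕ) : ℝ) * u i := fun α u => rfl
    have hstm : ∀ α, Measurable (st α) := fun α => by
      have : st α = fun u => (fun i => if (α i).1 then h i else 0) +
        fun i => ((((α i).2 : ℕ) + 1 : ℕ) : ℝ) * u i := funext fun u => hst' α u
      rw [this]
      fun_prop
    -- For every `u` in the box the fixed step `h` is compared with the steps `st α u`, which stay
    -- in the enlarged box `W`. The power mean inequality moves the exponent inside the sum over
    -- `α`; integration over `u` follows.
    have hle : ∀ u ∈ box t, eLpNorm (act (multiDiff n h) g) p volume ^ q ≤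
        ((2 ^ m) ^ d) ^ q * ((((2 * m) ^ d : ℕ) : ℝ≥0∞) ^ (q - 1) * ∑ α, Φ (st α u)) := by
      intro u hu
      rw [mem_box] at hu
      refine (ENNReal.rpow_le_rpow (eLpNorm_multiDiff_le_sum hm hp hn h u hg) hq.le).trans ?_
      rw [ENNReal.mul_rpow_of_nonneg _ _ hq.le]
      gcongr
      refine (ENNReal.rpow_sum_le_const_mul_sum_rpow _ _ hq1).trans ?_
      rw [hcard]
      gcongr with α
      have : st α u ∈ W := mem_box.2 fun i => avgStep_abs_lt (α i) (hh i) (hu i)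
      rw [hΦ, Set.indicator_of_mem this]
    calc eLpNorm (act (multiDiff n h) g) p volume ^ q * volume (box t)
        = ∫⁻ _ in box t, eLpNorm (act (multiDiff n h) g) p volume ^ q := by
          rw [setLIntegral_const]
      _ ≤ ∫⁻ u in box t,
          ((2 ^ m) ^ d) ^ q * ((((2 * m) ^ d : ℕ) : ℝ≥0∞) ^ (q - 1) * ∑ α, Φ (st α u)) :=
          setLIntegral_mono' (measurableSet_box t) hle
      _ ≤ ∫⁻ u, ((2 ^ m) ^ d) ^ q * ((((2 * m) ^ d : ℕ) : ℝ≥0∞) ^ (q - 1) * ∑ α, Φ (st α u)) :=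
          setLIntegral_le_lintegral _ _
      _ = ((2 ^ m) ^ d) ^ q * ((((2 * m) ^ d : ℕ) : ℝ≥0∞) ^ (q - 1) *
            ∑ α, ∫⁻ u, Φ (st α u)) := by
          have hs : Measurable fun u => ∑ α, Φ (st α u) :=
            Finset.measurable_sum _ fun α _ => hΦm.comp (hstm α)
          rw [lintegral_const_mul _ (hs.const_mul _), lintegral_const_mul _ hs,
            lintegral_finsetSum (f := fun α u => Φ (st α u)) _ fun α _ => hΦm.comp (hstm α)]
      _ ≤ ((2 ^ m) ^ d) ^ q * ((((2 * m) ^ d : ℕ) : ℝ≥0∞) ^ (q - 1) *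
            ∑ α : Fin d → Bool × Fin m, ∫⁻ v, Φ v) := by
          gcongr _ * (_ * ?_)
          refine Finset.sum_le_sum fun α _ => ?_
          simp only [hst']
          refine lintegral_comp_diagonal_le hΦm (fun i => ?_) _
          simp
      _ = X := by
          have h0 : ((2 * m) ^ d : ℕ) ≠ 0 := by positivity
          rw [Finset.sum_const, hcard, nsmul_eq_mul, hΦ, lintegral_indicator (measurableSet_box _),
            hX, mul_assoc, ← mul_assoc (_ ^ (q - 1))]
          congr 2
          nth_rw 2 [← ENNReal.rpow_one (((2 * m) ^ d : ℕ) : ℝ≥0∞)]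
          rw [← ENNReal.rpow_add _ _ (by exact_mod_cast h0) (ENNReal.natCast_ne_top _),
            sub_add_cancel]
  have hsup : orderModulus n p g t ^ q = ⨆ (h : Fin d → ℝ) (_ : ∀ i, |h i| < t i),
      eLpNorm (act (multiDiff n h) g) p volume ^ q := by
    exact (ENNReal.orderIsoRpow q hq).map_iSup₂ fun (h : Fin d → ℝ) (_ : ∀ i, |h i| < t i) =>
      eLpNorm (act (multiDiff n h) g) p volume
  rw [hsup]
  simp only [ENNReal.iSup_mul]
  exact iSup₂_le hpoint

/-- Suprema over steps and `ℓ_p` sums may be interchanged, at the cost of a constant and of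
larger steps. -/
theorem exists_lpSum_orderModulus_le {d m : ℕ} (hm : 0 < m) {p : ℝ≥0∞} (hp : 1 ≤ p)
    {n : Fin d → ℕ} (hn : ∀ i, n i = m ∨ n i = 0) : ∃ C : ℝ≥0∞, C ≠ ⊤ ∧
    ∀ (ι : Type) [Countable ι] (g : ι → (Fin d → ℝ) → ℂ),
      (∀ i, AEStronglyMeasurable (g i) volume) → ∀ t : Fin d → ℝ, (∀ i, 0 < t i) →
        (lpSum p fun i => orderModulus n p (g i) t) ≤
          C * ⨆ (v : Fin d → ℝ) (_ : ∀ i, |v i| < (m + 1) * t i),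
            lpSum p fun i => eLpNorm (act (multiDiff n v) (g i)) p volume := by
  by_cases hpt : p = ⊤
  · refine ⟨1, ENNReal.one_ne_top, fun ι _ g hg t ht => ?_⟩
    subst hpt
    rw [one_mul, lpSum_top]
    refine iSup_le fun i => iSup₂_le fun h hh => ?_
    refine le_iSup₂_of_le h (fun j => (hh j).trans_le ?_)
      (le_lpSum hp (fun i => eLpNorm (act (multiDiff n h) (g i)) ⊤ volume) i)
    have := ht j
    nlinarith [(Nat.cast_nonneg m : (0 : ℝ) ≤ m)]
  · set q := p.toReal with hqdef
    have hq : 0 < q := toReal_pos_of_one_le hp hpt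
    set B : ℝ≥0∞ := ((2 ^ m) ^ d) ^ q * (((2 * m) ^ d : ℕ) : ℝ≥0∞) ^ q with hB
    set A : ℝ≥0∞ := B * (m + 1) ^ d with hA
    have hA' : A ≠ ⊤ := by
      refine ENNReal.mul_ne_top (ENNReal.mul_ne_top ?_ ?_) ?_
      · exact ENNReal.rpow_ne_top_of_nonneg hq.le
          (ENNReal.pow_ne_top (ENNReal.pow_ne_top ENNReal.ofNat_ne_top))
      · exact ENNReal.rpow_ne_top_of_nonneg hq.le (ENNReal.natCast_ne_top _)
      · exact ENNReal.pow_ne_top (by exact_mod_cast ENNReal.natCast_ne_top (m + 1))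
    refine ⟨A ^ (1 / q), ENNReal.rpow_ne_top_of_nonneg (by positivity) hA', ?_⟩
    intro ι _ g hg t ht
    set S := ⨆ (v : Fin d → ℝ) (_ : ∀ i, |v i| < (m + 1) * t i),
            lpSum p fun i => eLpNorm (act (multiDiff n v) (g i)) p volume with hS
    rw [lpSum_le_iff hp hpt, ENNReal.mul_rpow_of_nonneg _ _ hq.le, ← ENNReal.rpow_mul,
      one_div_mul_cancel hq.ne', ENNReal.rpow_one]
    have hv0 : volume (box t) ≠ 0 := by
      rw [volume_box]
      exact Finset.prod_ne_zero_iff.2 fun i _ => by simp [ht i]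
    have hvt : volume (box t) ≠ ⊤ := by
      rw [volume_box]
      exact ENNReal.prod_ne_top fun i _ => ENNReal.ofReal_ne_top
    have hW : volume (box fun i => (m + 1) * t i) = (m + 1) ^ d * volume (box t) := by
      rw [volume_box, volume_box]
      have : ∀ i, ENNReal.ofReal (2 * ((m + 1) * t i))
          = ((m : ℝ≥0∞) + 1) * ENNReal.ofReal (2 * t i) := fun i => by
        rw [show 2 * ((m + 1) * t i) = ((m + 1 : ℕ) : ℝ) * (2 * t i) by push_cast; ring,
          ENNReal.ofReal_mul (by positivity), ENNReal.ofReal_natCast]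
        push_cast
        rfl
      simp [this, Finset.prod_mul_distrib]
    have hmeas : ∀ i, Measurable fun v =>
        eLpNorm (act (multiDiff n v) (g i)) p volume ^ q := fun i =>
      (measurable_eLpNorm_multiDiff hp hpt n (hg i)).pow_const _
    -- After multiplication by the volume of the box, the averaged bound applies termwise. Tonelli's
    -- theorem then puts the sum over `i` inside the integral, where all functions share the same
    -- step `v`.
    rw [← ENNReal.mul_le_mul_iff_left hv0 hvt, ← ENNReal.tsum_mul_right]
    calc ∑' i, orderModulus n p (g i) t ^ q * volume (box t)
        ≤ ∑' i, B * ∫⁻ v in box (fun i => (m + 1) * t i),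
            eLpNorm (act (multiDiff n v) (g i)) p volume ^ q :=
          ENNReal.tsum_le_tsum fun i => orderModulus_rpow_mul_volume_le hm hp hpt hn (hg i) t
      _ = B * ∫⁻ v in box (fun i => (m + 1) * t i),
            ∑' i, eLpNorm (act (multiDiff n v) (g i)) p volume ^ q := by
          rw [ENNReal.tsum_mul_left, lintegral_tsum fun i => (hmeas i).aemeasurable]
      _ ≤ B * ∫⁻ v in box (fun i => (m + 1) * t i), S ^ q := by
          gcongr B * ?_
          refine setLIntegral_mono' (measurableSet_box _) fun v hv => ?_
          rw [← lpSum_rpow hp hpt]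
          refine ENNReal.rpow_le_rpow ?_ hq.le
          rw [mem_box] at hv
          exact le_iSup₂ (f := fun (v : Fin d → ℝ) (_ : ∀ i, |v i| < (m + 1) * t i) =>
            lpSum p fun i => eLpNorm (act (multiDiff n v) (g i)) p volume) v hv
      _ = A * S ^ q * volume (box t) := by
          rw [setLIntegral_const, hW, hA]
          ring

/-! ### The Leibniz rule -/

/-- A product `g f` is the restriction of `g ⊗ f` to the diagonal of `H × H`. There the diagonal
translation factors into translations of the two variables, which reduces the Leibniz rule to
algebra in `ℂ[H × H]`. -/
theorem act_diag {H : Type*} [AddCommGroup H] (a : AddMonoidAlgebra ℂ H) (F : H × H → ℂ) (x : H) :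
    act (AddMonoidAlgebra.mapDomainRingHom ℂ
      ((AddMonoidHom.id H).prod (AddMonoidHom.id H)) a) F (x, x) = act a (fun y => F (y, y)) x := by
  induction a using AddMonoidAlgebra.induction_linear with
  | zero => simp
  | add a b ha hb => rw [map_add, act_add, act_add, Pi.add_apply, Pi.add_apply, ha, hb]
  | single y c =>
    simp [AddMonoidAlgebra.mapDomainRingHom_apply, AddMonoidAlgebra.mapDomain_single, act_single]

theorem act_inl {H : Type*} [AddCommGroup H] (a : AddMonoidAlgebra ℂ H) (F : H × H → ℂ) (x y : H) :
    act (AddMonoidAlgebra.mapDomainRingHom ℂ (AddMonoidHom.inl H H) a) F (x, y) =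
      act a (fun x' => F (x', y)) x := by
  induction a using AddMonoidAlgebra.induction_linear with
  | zero => simp
  | add a b ha hb => rw [map_add, act_add, act_add, Pi.add_apply, Pi.add_apply, ha, hb]
  | single y c =>
    simp [AddMonoidAlgebra.mapDomainRingHom_apply, AddMonoidAlgebra.mapDomain_single, act_single]

theorem act_inr {H : Type*} [AddCommGroup H] (a : AddMonoidAlgebra ℂ H) (F : H × H → ℂ) (x y : H) :
    act (AddMonoidAlgebra.mapDomainRingHom ℂ (AddMonoidHom.inr H H) a) F (x, y) =
      act a (fun y' => F (x, y')) y := by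
  induction a using AddMonoidAlgebra.induction_linear with
  | zero => simp
  | add a b ha hb => rw [map_add, act_add, act_add, Pi.add_apply, Pi.add_apply, ha, hb]
  | single y c =>
    simp [AddMonoidAlgebra.mapDomainRingHom_apply, AddMonoidAlgebra.mapDomain_single, act_single]

theorem act_inl_mul_inr {H : Type*} [AddCommGroup H] (a b : AddMonoidAlgebra ℂ H) (g f : H → ℂ)
    (x y : H) :
    act (AddMonoidAlgebra.mapDomainRingHom ℂ (AddMonoidHom.inl H H) a *
      AddMonoidAlgebra.mapDomainRingHom ℂ (AddMonoidHom.inr H H) b)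
      (fun z => g z.1 * f z.2) (x, y) = act a g x * act b f y := by
  have h1 : ∀ x', act b (fun y' => g x' * f y') y = g x' * act b f y := fun x' => by
    have : (fun y' => g x' * f y') = g x' • f := rfl
    rw [this, map_smul, Pi.smul_apply, smul_eq_mul]
  have h2 : act a (fun x' => g x' * act b f y) x = act a g x * act b f y := by
    have : (fun x' => g x' * act b f y) = act b f y • g := by
      funext x'
      rw [Pi.smul_apply, smul_eq_mul, mul_comm]
    rw [this, map_smul, Pi.smul_apply, smul_eq_mul, mul_comm]
  rw [act_mul, act_inl]
  simp only [act_inr, h1, h2]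

/-- The first order product rule, in the form `S ⊗ S - 1 = (S ⊗ 1)(1 ⊗ (S - 1)) + (S - 1) ⊗ 1`. -/
theorem diag_diff {d : ℕ} (t : ℝ) (i : Fin d) :
    AddMonoidAlgebra.mapDomainRingHom ℂ
      ((AddMonoidHom.id (Fin d → ℝ)).prod (AddMonoidHom.id _)) (diff t i) =
    AddMonoidAlgebra.mapDomainRingHom ℂ (AddMonoidHom.inl _ _) (shift t i) *
      AddMonoidAlgebra.mapDomainRingHom ℂ (AddMonoidHom.inr _ _) (diff t i) +
      AddMonoidAlgebra.mapDomainRingHom ℂ (AddMonoidHom.inl _ _) (diff t i) := by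
  simp only [diff, map_sub, map_one, mul_sub, mul_one]
  rw [sub_add_sub_cancel]
  congr 1
  simp [shift, AddMonoidAlgebra.mapDomainRingHom_apply, AddMonoidAlgebra.mapDomain_single,
    AddMonoidAlgebra.single_mul_single]

/-- The Leibniz rule for mixed differences. -/
theorem act_multiDiff_mul {d : ℕ} (n : Fin d → ℕ) (h : Fin d → ℝ) (g f : (Fin d → ℝ) → ℂ)
    (x : Fin d → ℝ) :
    act (multiDiff n h) (fun y => g y * f y) x =
      ∑ k ∈ Fintype.piFinset fun i => range (n i + 1), ((∏ i, (n i).choose (k i) : ℕ) : ℂ) *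
        (act ((∏ i, shift (h i) i ^ k i) * multiDiff (fun i => n i - k i) h) g x *
          act (multiDiff k h) f x) := by
  rw [← act_diag (multiDiff n h) (fun z => g z.1 * f z.2) x]
  have : AddMonoidAlgebra.mapDomainRingHom ℂ
      ((AddMonoidHom.id (Fin d → ℝ)).prod (AddMonoidHom.id _)) (multiDiff n h) =
      ∑ k ∈ Fintype.piFinset fun i => range (n i + 1), ((∏ i, (n i).choose (k i) : ℕ) : ℂ) •
        (AddMonoidAlgebra.mapDomainRingHom ℂ (AddMonoidHom.inl _ _)
          ((∏ i, shift (h i) i ^ k i) * multiDiff (fun i => n i - k i) h) *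
        AddMonoidAlgebra.mapDomainRingHom ℂ (AddMonoidHom.inr _ _) (multiDiff k h)) := by
    simp only [multiDiff, map_prod, map_pow, diag_diff, add_pow]
    rw [Finset.prod_univ_sum]
    refine Finset.sum_congr rfl fun k _ => ?_
    rw [Algebra.smul_def, map_natCast]
    push_cast
    simp only [map_mul, map_prod, map_pow, ← Finset.prod_mul_distrib, mul_pow]
    refine Finset.prod_congr rfl fun i _ => ?_
    ring
  rw [this, act_sum, Finset.sum_apply]
  refine Finset.sum_congr rfl fun k _ => ?_
  rw [act_smul, Pi.smul_apply, act_inl_mul_inr, smul_eq_mul]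

/-! ### Differences of smooth functions -/

theorem multiDiff_zero {d : ℕ} (h : Fin d → ℝ) : multiDiff 0 h = 1 := by
  simp [multiDiff]

theorem multiDiff_update_succ {d : ℕ} (n : Fin d → ℕ) (h : Fin d → ℝ) (i : Fin d) :
    multiDiff (Function.update n i (n i + 1)) h = diff (h i) i * multiDiff n h := by
  simp only [multiDiff]
  rw [← Finset.mul_prod_erase univ _ (Finset.mem_univ i),
    ← Finset.mul_prod_erase univ (fun j => diff (h j) j ^ n j) (Finset.mem_univ i),
    Function.update_self, pow_succ', mul_assoc]
  congr 2
  refine Finset.prod_congr rfl fun j hj => ?_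
  rw [Function.update_of_ne (Finset.ne_of_mem_erase hj)]

theorem hasDerivAt_act {d : ℕ} (a : TransAlg d) {φ : (Fin d → ℝ) → ℂ} (hφ : ContDiff ℝ ∞ φ)
    (x : Fin d → ℝ) (i : Fin d) (s : ℝ) :
    HasDerivAt (fun s : ℝ => act a φ (x + Pi.single i s))
      (act a (fun y => fderiv ℝ φ y (Pi.single i 1)) (x + Pi.single i s)) s := by
  induction a using AddMonoidAlgebra.induction_linear with
  | zero => simpa using hasDerivAt_const s (0 : ℂ)
  | add a b ha hb => simp only [act_add, Pi.add_apply]; exact ha.add hb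
  | single y c =>
    simp only [act_single]
    refine HasDerivAt.const_mul c ?_
    have h1 : HasDerivAt (fun s : ℝ => x + Pi.single i s + y) (Pi.single i 1) s := by
      have := ((hasDerivAt_single i s).const_add x).add_const y
      simpa using this
    exact ((hφ.differentiable (by simp)) _).hasFDerivAt.comp_hasDerivAt s h1

/-- Induction on the total order: one difference in direction `i` is removed by the mean value
inequality at the cost of a factor `|h i|`. The remaining difference falls on the `i`-th partial
derivative, which is again smooth with compact support. -/
theorem exists_norm_act_multiDiff_le {d : ℕ} (n : Fin d → ℕ) :
    ∀ φ : (Fin d → ℝ) → ℂ, ContDiff ℝ ∞ φ → HasCompactSupport φ →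
      ∃ C : ℝ, 0 ≤ C ∧ ∀ h x, ‖act (multiDiff n h) φ x‖ ≤ C * ∏ i, |h i| ^ n i := by
  induction hN : ∑ i, n i generalizing n with
  | zero =>
    intro φ hφ hs
    have hn : n = 0 := by
      funext i
      exact (Finset.sum_eq_zero_iff.1 hN) i (Finset.mem_univ i)
    obtain ⟨C, hC⟩ := hφ.continuous.bounded_above_of_compact_support hs
    refine ⟨C, (norm_nonneg _).trans (hC 0), fun h x => ?_⟩
    subst hn
    simpa [multiDiff_zero, act_one] using hC x
  | succ N ih =>
    intro φ hφ hs
    obtain ⟨i, -, hi⟩ : ∃ i ∈ univ, n i ≠ 0 := by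
      by_contra! hcon
      rw [Finset.sum_eq_zero hcon] at hN
      omega
    set n' := Function.update n i (n i - 1) with hn'
    have hnn : Function.update n' i (n' i + 1) = n := by
      funext j
      by_cases hj : j = i
      · subst hj; simp [hn']; omega
      · simp [hn', hj]
    have hprod : ∀ h : Fin d → ℝ, ∏ j, |h j| ^ n j = |h i| * ∏ j, |h j| ^ n' j := fun h => by
      rw [← Finset.mul_prod_erase univ _ (Finset.mem_univ i),
        ← Finset.mul_prod_erase univ (fun j => |h j| ^ n' j) (Finset.mem_univ i), ← mul_assoc,
        ← pow_succ']
      congr 1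
      · rw [hn', Function.update_self, Nat.sub_add_cancel (Nat.pos_of_ne_zero hi)]
      · refine Finset.prod_congr rfl fun j hj => ?_
        rw [hn', Function.update_of_ne (Finset.ne_of_mem_erase hj)]
    have hsum : ∑ j, n' j = N := by
      have h1 := Finset.add_sum_erase univ n (Finset.mem_univ i)
      have h2 := Finset.add_sum_erase univ n' (Finset.mem_univ i)
      have h3 : ∑ j ∈ univ.erase i, n' j = ∑ j ∈ univ.erase i, n j :=
        Finset.sum_congr rfl fun j hj => by
          rw [hn', Function.update_of_ne (Finset.ne_of_mem_erase hj)]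
      have h4 : n' i = n i - 1 := by rw [hn', Function.update_self]
      omega
    obtain ⟨C, hC0, hC⟩ := ih n' hsum (fun y => fderiv ℝ φ y (Pi.single i 1))
      ((hφ.fderiv_right (by simp)).clm_apply contDiff_const) (hs.fderiv_apply ℝ _)
    refine ⟨C, hC0, fun h x => ?_⟩
    rw [← hnn, multiDiff_update_succ, hnn, act_mul, act_diff]
    have := Convex.norm_image_sub_le_of_norm_hasDerivWithin_le
      (f := fun s : ℝ => act (multiDiff n' h) φ (x + Pi.single i s)) (s := Set.univ) (x := 0)
      (y := h i) (C := C * ∏ j, |h j| ^ n' j)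
      (fun s _ => (hasDerivAt_act (multiDiff n' h) hφ x i s).hasDerivWithinAt)
      (fun s _ => hC h _) convex_univ trivial trivial
    simp only [Pi.single_zero, add_zero, sub_zero, Real.norm_eq_abs] at this
    rw [hprod]
    refine this.trans (le_of_eq ?_)
    ring

/-- `a` does not increase the supremum norm. -/
def IsSupContraction {d : ℕ} (a : TransAlg d) : Prop :=
  ∀ (f : (Fin d → ℝ) → ℂ) (B : ℝ), (∀ x, ‖f x‖ ≤ B) → ∀ x, ‖act a f x‖ ≤ B

theorem IsSupContraction.mul {d : ℕ} {a b : TransAlg d} (ha : IsSupContraction a)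
    (hb : IsSupContraction b) : IsSupContraction (a * b) := by
  intro f B hB
  rw [act_mul]
  exact ha _ B (hb f B hB)

theorem isSupContraction_prod {d : ℕ} {ι : Type*} (s : Finset ι) {a : ι → TransAlg d}
    (h : ∀ i ∈ s, IsSupContraction (a i)) : IsSupContraction (∏ i ∈ s, a i) := by
  classical
  induction s using Finset.induction_on with
  | empty => intro f B hB; simpa [act_one] using hB
  | insert i s hi ih =>
    rw [Finset.prod_insert hi]
    exact (h i (by simp)).mul (ih fun j hj => h j (by simp [hj]))

theorem isSupContraction_prod_shift {d : ℕ} (k : Fin d → ℕ) (h : Fin d → ℝ) :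
    IsSupContraction (∏ i, shift (h i) i ^ k i) := by
  refine isSupContraction_prod _ fun i _ => ?_
  rw [← shift_nat_mul]
  intro f B hB x
  rw [act_shift]
  exact hB _

theorem act_comp_sub {d : ℕ} (a : TransAlg d) (g : (Fin d → ℝ) → ℂ) (c x : Fin d → ℝ) :
    act a (fun y => g (y - c)) x = act a g (x - c) := by
  induction a using AddMonoidAlgebra.induction_linear with
  | zero => simp
  | add a b ha hb => rw [act_add, act_add, Pi.add_apply, Pi.add_apply, ha, hb]
  | single y c' => rw [act_single, act_single]; congr 2; abel

/-! ### Localizations -/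

/-- The lattice points at distance at most `K` from `x`. -/
noncomputable def latticeBall {d : ℕ} (K : ℕ) (x : Fin d → ℝ) : Finset (Fin d → ℤ) :=
  Fintype.piFinset fun i => Finset.Icc ⌈x i - K⌉ ⌊x i + K⌋

theorem card_latticeBall_le {d : ℕ} (K : ℕ) (x : Fin d → ℝ) :
    #(latticeBall K x) ≤ (2 * K + 1) ^ d := by
  rw [latticeBall, Fintype.card_piFinset]
  refine (Finset.prod_le_pow_card _ _ (2 * K + 1) fun i _ => ?_).trans (by simp)
  rw [Int.card_Icc, Int.toNat_le]
  have h1 := Int.floor_le (x i + K)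
  have h2 := Int.le_ceil (x i - K)
  have : ((⌊x i + K⌋ : ℤ) : ℝ) ≤ ((⌈x i - K⌉ + 2 * K : ℤ) : ℝ) := by push_cast; linarith
  have := Int.cast_le.1 this
  push_cast
  linarith

theorem lt_norm_of_notMem_latticeBall {d K : ℕ} {x : Fin d → ℝ} {μ : Fin d → ℤ}
    (h : μ ∉ latticeBall K x) : (K : ℝ) < ‖x - fun i => (μ i : ℝ)‖ := by
  by_contra! hle
  refine h (Fintype.mem_piFinset.2 fun i => ?_)
  have h1 : |x i - μ i| ≤ K := (norm_le_pi_norm (x - fun i => (μ i : ℝ)) i).trans hle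
  rw [abs_le] at h1
  rw [Finset.mem_Icc, Int.ceil_le, Int.le_floor]
  constructor <;> linarith

theorem exists_radius {d : ℕ} {ψ : (Fin d → ℝ) → ℝ} (hs : HasCompactSupport ψ) :
    ∃ ρ : ℕ, ∀ x, (ρ : ℝ) < ‖x‖ → ψ x = 0 := by
  obtain ⟨R, hR⟩ := hs.isCompact.isBounded.subset_closedBall 0
  obtain ⟨ρ, hρ⟩ := exists_nat_ge R
  refine ⟨ρ, fun x hx => ?_⟩
  by_contra hne
  have := hR (subset_tsupport _ hne)
  rw [mem_closedBall_zero_iff] at this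
  linarith

theorem act_localize_eq_zero {d : ℕ} {ψ : (Fin d → ℝ) → ℝ} {ρ L : ℕ}
    (hρ : ∀ x, (ρ : ℝ) < ‖x‖ → ψ x = 0) {a : TransAlg d} (ha : IsLocal L a)
    (f : (Fin d → ℝ) → ℂ) {x : Fin d → ℝ} {μ : Fin d → ℤ} (hμ : μ ∉ latticeBall (ρ + L) x) :
    act a (localize ψ μ f) x = 0 := by
  refine ha _ x fun y hy => ?_
  have h1 := lt_norm_of_notMem_latticeBall hμ
  have h2 : ‖x - fun i => (μ i : ℝ)‖ ≤ ‖y - x‖ + ‖y - fun i => (μ i : ℝ)‖ := by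
    rw [← norm_neg (y - x)]
    refine le_trans (le_of_eq ?_) (norm_add_le _ _)
    congr 1
    abel
  have h3 : ψ (fun i => y i - (μ i : ℝ)) = 0 := hρ (y - fun i => (μ i : ℝ)) (by
    push_cast at h1
    linarith)
  simp [localize, h3]

theorem aestronglyMeasurable_localize {d : ℕ} {ψ : (Fin d → ℝ) → ℝ} (hψ : Continuous ψ)
    (μ : Fin d → ℤ) {f : (Fin d → ℝ) → ℂ} (hf : AEStronglyMeasurable f volume) :
    AEStronglyMeasurable (localize ψ μ f) volume := by
  have : Continuous fun x : Fin d → ℝ => (ψ (fun i => x i - (μ i : ℝ)) : ℂ) := by fun_prop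
  exact this.aestronglyMeasurable.mul hf

/-- The `ℓ_p` sum of the norms of a mixed difference of the localizations. -/
theorem exists_lpSum_localize_le {d : ℕ} {p : ℝ≥0∞} (hp : 1 ≤ p) {ψ : (Fin d → ℝ) → ℝ}
    (hψ : ContDiff ℝ ∞ ψ) (hs : HasCompactSupport ψ) (n : Fin d → ℕ) (L : ℕ) :
    ∃ C : ℝ≥0∞, C ≠ ⊤ ∧ ∀ f : (Fin d → ℝ) → ℂ, AEStronglyMeasurable f volume →
      ∀ v : Fin d → ℝ, ∑ i, n i * |v i| ≤ L →
        (lpSum p fun μ => eLpNorm (act (multiDiff n v) (localize ψ μ f)) p volume) ≤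
          C * ∑ k ∈ Fintype.piFinset fun i => range (n i + 1),
            ENNReal.ofReal (∏ i, |v i| ^ (n i - k i)) * eLpNorm (act (multiDiff k v) f) p volume := by
  obtain ⟨ρ, hρ⟩ := exists_radius hs
  set φ : (Fin d → ℝ) → ℂ := fun x => (ψ x : ℂ) with hφ
  have hφs : ContDiff ℝ ∞ φ := Complex.ofRealCLM.contDiff.comp hψ
  have hφc : HasCompactSupport φ := hs.comp_left (g := fun y : ℝ => (y : ℂ)) (by simp)
  choose C hC0 hC using fun k : Fin d → ℕ =>
    exists_norm_act_multiDiff_le (fun i => n i - k i) φ hφs hφc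
  set P := Fintype.piFinset fun i => range (n i + 1) with hP
  set A : ℝ := ∑ k ∈ P, ((∏ i, (n i).choose (k i) : ℕ) : ℝ) * C k with hA
  have hAk : ∀ k ∈ P, ((∏ i, (n i).choose (k i) : ℕ) : ℝ) * C k ≤ A := fun k hk =>
    Finset.single_le_sum (f := fun k => ((∏ i, (n i).choose (k i) : ℕ) : ℝ) * C k)
      (fun k _ => mul_nonneg (Nat.cast_nonneg _) (hC0 k)) hk
  have hA0 : 0 ≤ A := Finset.sum_nonneg fun k _ => mul_nonneg (Nat.cast_nonneg _) (hC0 k)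
  set N : ℕ := (2 * (ρ + L) + 1) ^ d with hN
  refine ⟨N * ENNReal.ofReal A, ENNReal.mul_ne_top (ENNReal.natCast_ne_top _)
    ENNReal.ofReal_ne_top, fun f hf v hv => ?_⟩
  -- The Leibniz majorant does not depend on `μ`, since the bounds for differences of `ψ` are
  -- invariant under translation. Finite overlap then controls the whole sum over `μ`.
  set G : (Fin d → ℝ) → ℝ := ∑ k ∈ P, (A * ∏ i, |v i| ^ (n i - k i)) •
    fun x => ‖act (multiDiff k v) f x‖ with hG
  have hmain := lpSum_eLpNorm_le_of_overlap (ν := volume) hp (N := N) (Nat.one_le_pow _ _ (by omega))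
    (F := fun μ => act (multiDiff n v) (localize ψ μ f))
    (fun μ => aestronglyMeasurable_act _ (aestronglyMeasurable_localize hψ.continuous μ hf))
    (G := G) (latticeBall (ρ + L)) (card_latticeBall_le _)
    (fun μ x hμ => act_localize_eq_zero hρ ((isLocal_multiDiff n v).mono hv) f hμ) ?_
  · refine hmain.trans ?_
    rw [mul_assoc]
    gcongr
    refine (eLpNorm_sum_le (fun k _ =>
      ((aestronglyMeasurable_act _ hf).norm.const_smul _)) hp).trans ?_
    rw [Finset.mul_sum]
    refine Finset.sum_le_sum fun k _ => ?_
    have hprod : 0 ≤ ∏ i, |v i| ^ (n i - k i) := Finset.prod_nonneg fun i _ => by positivity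
    rw [eLpNorm_const_smul, eLpNorm_norm, Real.enorm_of_nonneg (mul_nonneg hA0 hprod),
      ENNReal.ofReal_mul hA0, mul_assoc]
  · intro μ x
    rw [hG, Finset.sum_apply]
    have hloc : localize ψ μ f = fun y => φ (y - fun i => (μ i : ℝ)) * f y := rfl
    rw [hloc, act_multiDiff_mul n v (fun y => φ (y - fun i => (μ i : ℝ)))]
    refine (norm_sum_le _ _).trans (Finset.sum_le_sum fun k hk => ?_)
    rw [Pi.smul_apply, smul_eq_mul, norm_mul, norm_mul, Complex.norm_natCast, ← mul_assoc]
    refine mul_le_mul_of_nonneg_right ?_ (norm_nonneg _)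
    have h1 := isSupContraction_prod_shift k v
      (act (multiDiff (fun i => n i - k i) v) φ) _ (hC k v) (x - fun i => (μ i : ℝ))
    rw [act_comp_sub, act_mul]
    calc _ ≤ ((∏ i, (n i).choose (k i) : ℕ) : ℝ) * (C k * ∏ i, |v i| ^ (n i - k i)) := by
          gcongr
      _ = (((∏ i, (n i).choose (k i) : ℕ) : ℝ) * C k) * ∏ i, |v i| ^ (n i - k i) := by ring
      _ ≤ A * ∏ i, |v i| ^ (n i - k i) := by
          gcongr
          exact hAk k hk

/-! ### Comparison of moduli -/

theorem multiDiff_congr {d : ℕ} {n : Fin d → ℕ} {h h' : Fin d → ℝ}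
    (H : ∀ i, n i ≠ 0 → h i = h' i) : multiDiff n h = multiDiff n h' := by
  refine Finset.prod_congr rfl fun i _ => ?_
  by_cases hi : n i = 0
  · simp [hi]
  · rw [H i hi]

theorem multiDiff_eq_pow_mul {d : ℕ} (n : Fin d → ℕ) (h : Fin d → ℝ) (i : Fin d) :
    multiDiff n h = diff (h i) i ^ n i * multiDiff (Function.update n i 0) h := by
  simp only [multiDiff]
  rw [← Finset.mul_prod_erase univ _ (Finset.mem_univ i),
    ← Finset.mul_prod_erase univ (fun j => diff (h j) j ^ Function.update n i 0 j)
      (Finset.mem_univ i), Function.update_self, pow_zero, one_mul]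
  congr 1
  refine Finset.prod_congr rfl fun j hj => ?_
  rw [Function.update_of_ne (Finset.ne_of_mem_erase hj)]

theorem orderModulus_le_update_zero {d : ℕ} {p : ℝ≥0∞} (hp : 1 ≤ p) (n : Fin d → ℕ) (i : Fin d)
    {f : (Fin d → ℝ) → ℂ} (hf : AEStronglyMeasurable f volume) (t : Fin d → ℝ) :
    orderModulus n p f t ≤ 2 ^ n i * orderModulus (Function.update n i 0) p f t := by
  refine iSup₂_le fun h hh => ?_
  rw [multiDiff_eq_pow_mul n h i, act_mul]
  refine ((bd_diff hp _ i).pow (n i) _ (aestronglyMeasurable_act _ hf)).trans ?_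
  gcongr
  exact eLpNorm_le_orderModulus _ p f hh

/-- A difference with step `v i` is a sum of `N` translates of the difference with step `v i / N`,
by the geometric sum. -/
theorem eLpNorm_le_pow_mul_orderModulus {d : ℕ} {p : ℝ≥0∞} (hp : 1 ≤ p) (n : Fin d → ℕ) {N : ℕ}
    (hN : 0 < N) {f : (Fin d → ℝ) → ℂ} (hf : AEStronglyMeasurable f volume) {t v : Fin d → ℝ}
    (hv : ∀ i, |v i| < N * t i) :
    eLpNorm (act (multiDiff n v) f) p volume ≤ (∏ i, (N : ℝ≥0∞) ^ n i) * orderModulus n p f t := by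
  have hN' : (0 : ℝ) < N := by exact_mod_cast hN
  have : multiDiff n v = (∏ i, (∑ l ∈ range N, shift (v i / N) i ^ l) ^ n i) *
      multiDiff n fun i => v i / N := by
    simp only [multiDiff, ← Finset.prod_mul_distrib, ← mul_pow, ← diff_nat_mul]
    refine Finset.prod_congr rfl fun i _ => ?_
    rw [mul_div_cancel₀ _ hN'.ne']
  rw [this, act_mul]
  have hB : Bd p (∏ i, (N : ℝ≥0∞) ^ n i)
      (∏ i, (∑ l ∈ range N, shift (v i / N) i ^ l) ^ n i) := by
    refine bd_prod _ fun i _ => Bd.pow ?_ _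
    have := bd_sum hp (range N) (a := fun l => shift (v i / N) i ^ l) (K := fun l => 1 ^ l)
      fun l _ => (bd_shift p _ i).pow l
    simpa using this
  refine (hB _ (aestronglyMeasurable_act _ hf)).trans ?_
  gcongr
  refine eLpNorm_le_orderModulus _ p f fun i => ?_
  rw [abs_div, Nat.abs_cast, div_lt_iff₀ hN', mul_comm]
  exact hv i

/-- With `S` the shift, `S² - 1 = (S + 1)(S - 1)`, and `(S + 1)^j - 2^j` is divisible by `(S + 1) -
2 = S - 1`. The remainder therefore has one order more. -/
theorem two_pow_mul_diff_pow {d : ℕ} (t : ℝ) (i : Fin d) (j : ℕ) :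
    2 ^ j * diff t i ^ j = diff (2 * t) i ^ j -
      (∑ l ∈ range j, (shift t i + 1) ^ l * 2 ^ (j - 1 - l)) * diff t i ^ (j + 1) := by
  have h1 : diff (2 * t) i = (shift t i + 1) * diff t i := by
    have := diff_nat_mul 2 t i
    rw [Nat.cast_ofNat] at this
    rw [this, Finset.sum_range_succ, Finset.sum_range_one, pow_zero, pow_one, add_comm]
  have h2 := geom_sum₂_mul (shift t i + 1) (2 : TransAlg d) j
  have h3 : shift t i + 1 - 2 = diff t i := by rw [diff]; ring
  rw [h3] at h2
  rw [h1, mul_pow, pow_succ', ← mul_assoc _ (diff t i), h2]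
  ring

/-- A discrete Marchaud inequality. -/
theorem exists_orderModulus_le {d : ℕ} {p : ℝ≥0∞} (hp : 1 ≤ p) (n : Fin d → ℕ) (i : Fin d) :
    ∃ C : ℝ≥0∞, C ≠ ⊤ ∧ ∀ f : (Fin d → ℝ) → ℂ, AEStronglyMeasurable f volume →
      ∀ t : Fin d → ℝ, orderModulus n p f t ≤
        2⁻¹ ^ n i * orderModulus n p f (Function.update t i (2 * t i)) +
          C * orderModulus (Function.update n i (n i + 1)) p f t := by
  set j := n i with hj
  set K : ℝ≥0∞ := ∑ l ∈ range j, (1 + 1) ^ l * (1 + 1) ^ (j - 1 - l) with hK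
  have hKt : K ≠ ⊤ := ENNReal.sum_ne_top.2 fun l _ => by finiteness
  refine ⟨2⁻¹ ^ j * K, ENNReal.mul_ne_top (by finiteness) hKt, fun f hf t => ?_⟩
  refine iSup₂_le fun h hh => ?_
  set Q : TransAlg d := ∑ l ∈ range j, (shift (h i) i + 1) ^ l * 2 ^ (j - 1 - l) with hQ
  have hQb : Bd p K Q := bd_sum hp _ fun l _ =>
    (((bd_shift p _ i).add hp (bd_one p)).pow l).mul (Bd.pow (by
      rw [← one_add_one_eq_two]
      exact (bd_one p).add hp (bd_one p)) _)
  set h2 := Function.update h i (2 * h i) with hh2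
  have hR : multiDiff (Function.update n i 0) h2 = multiDiff (Function.update n i 0) h := by
    refine multiDiff_congr fun k hk => ?_
    by_cases hki : k = i
    · subst hki; simp at hk
    · rw [hh2, Function.update_of_ne hki]
  have h2i : h2 i = 2 * h i := by rw [hh2, Function.update_self]
  have hsucc : multiDiff (Function.update n i (j + 1)) h =
      diff (h i) i ^ (j + 1) * multiDiff (Function.update n i 0) h := by
    have := multiDiff_eq_pow_mul (Function.update n i (j + 1)) h i
    rwa [Function.update_self, Function.update_idem] at this
  have hid : multiDiff n h = ((2⁻¹ : ℂ) ^ j) • (multiDiff n h2 -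
      Q * multiDiff (Function.update n i (j + 1)) h) := by
    have hmul : (2 : TransAlg d) ^ j * multiDiff n h =
        multiDiff n h2 - Q * multiDiff (Function.update n i (j + 1)) h := by
      rw [hsucc, multiDiff_eq_pow_mul n h i, multiDiff_eq_pow_mul n h2 i, hR, h2i, ← hj,
        ← mul_assoc, two_pow_mul_diff_pow, ← hQ]
      ring
    have htwo : (2 : TransAlg d) ^ j = algebraMap ℂ (TransAlg d) (2 ^ j) := by
      rw [map_pow, map_ofNat]
    rw [← hmul, htwo, ← Algebra.smul_def, smul_smul, ← mul_pow]
    simp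
  have hcoef : ‖(2⁻¹ : ℂ) ^ j‖ₑ = 2⁻¹ ^ j := by
    rw [enorm_pow, enorm_inv two_ne_zero]
    congr 2
    rw [← ofReal_norm]
    simp
  rw [hid, act_smul, act_sub, eLpNorm_const_smul, hcoef, mul_assoc, ← mul_add, act_mul]
  gcongr
  refine (eLpNorm_sub_le (aestronglyMeasurable_act _ hf)
    (aestronglyMeasurable_act _ (aestronglyMeasurable_act _ hf)) hp).trans ?_
  refine add_le_add ?_ ?_
  · refine eLpNorm_le_orderModulus _ p f fun k => ?_
    by_cases hk : k = i
    · subst hk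
      rw [Function.update_self, h2i, abs_mul, abs_two]
      linarith [hh k]
    · rw [Function.update_of_ne hk, hh2, Function.update_of_ne hk]
      exact hh k
  · refine (hQb _ (aestronglyMeasurable_act _ hf)).trans ?_
    gcongr
    exact eLpNorm_le_orderModulus _ p f hh

/-! ### Weighted norms of the moduli -/

/-- The weighted `ℓ_p` norm of the dyadic moduli of order `n`, with weight `2^{(s + n_i) k_i}` in
direction `i`, over the indices supported on `e`. -/
noncomputable def orderNorm {d : ℕ} (s : ℝ) (e : Finset (Fin d)) (n : Fin d → ℕ) (p : ℝ≥0∞)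
    (f : (Fin d → ℝ) → ℂ) : ℝ≥0∞ :=
  lpSum p fun k : {k : Fin d → ℕ // ∀ i, i ∉ e → k i = 0} =>
    ENNReal.ofReal ((2 : ℝ) ^ (∑ i, (s + n i) * (k.1 i : ℝ))) *
      orderModulus n p f fun i => (1 / 2 : ℝ) ^ k.1 i

/-- With `s = r - m` and order `m` on `e`, the exponent `s + n_i` equals `r` for `i ∈ e`; outside
`e` the weight is irrelevant because `k_i = 0`. -/
theorem besovNorm_eq_sum_orderNorm {d : ℕ} (r : ℝ) (p : ℝ≥0∞) (f : (Fin d → ℝ) → ℂ) :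
    besovNorm r p f = ∑ e : Finset (Fin d),
      orderNorm (r - (⌊r⌋₊ + 1 : ℕ)) e (constOrder (⌊r⌋₊ + 1) e) p f := by
  refine Finset.sum_congr rfl fun e _ => ?_
  unfold orderNorm
  congr 1
  funext k
  rw [modulus_eq_orderModulus _ _ _ _ fun i => by positivity]
  congr 3
  rw [Finset.mul_sum]
  refine Finset.sum_congr rfl fun i _ => ?_
  by_cases hi : i ∈ e
  · simp [constOrder, hi]
  · simp [k.2 i hi]

theorem orderNorm_le_besovNorm {d : ℕ} (r : ℝ) (p : ℝ≥0∞) (f : (Fin d → ℝ) → ℂ)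
    (e : Finset (Fin d)) :
    orderNorm (r - (⌊r⌋₊ + 1 : ℕ)) e (constOrder (⌊r⌋₊ + 1) e) p f ≤ besovNorm r p f := by
  rw [besovNorm_eq_sum_orderNorm]
  exact Finset.single_le_sum (f := fun e =>
    orderNorm (r - (⌊r⌋₊ + 1 : ℕ)) e (constOrder (⌊r⌋₊ + 1) e) p f)
    (fun _ _ => zero_le) (Finset.mem_univ e)

theorem sum_mul_update_succ {d : ℕ} (w : Fin d → ℝ) (k : Fin d → ℕ) (i : Fin d) :
    ∑ j, w j * ((Function.update k i (k i + 1) j : ℕ) : ℝ) = w i + ∑ j, w j * (k j : ℝ) := by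
  rw [← Finset.add_sum_erase univ _ (Finset.mem_univ i),
    ← Finset.add_sum_erase univ (fun j => w j * (k j : ℝ)) (Finset.mem_univ i),
    Function.update_self]
  have : ∑ j ∈ univ.erase i, w j * ((Function.update k i (k i + 1) j : ℕ) : ℝ)
      = ∑ j ∈ univ.erase i, w j * (k j : ℝ) := Finset.sum_congr rfl fun j hj => by
    rw [Function.update_of_ne (Finset.ne_of_mem_erase hj)]
  rw [this]
  push_cast
  ring

/-- The Marchaud inequality is a recursion in `k_i`, solved by the discrete Hardy inequality. At the
bottom level `k_i = 0` the difference in direction `i` is simply bounded away, which leaves the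
index set `e.erase i`. -/
theorem exists_orderNorm_le {d : ℕ} {p : ℝ≥0∞} (hp : 1 ≤ p) {s : ℝ} (hs : s < 0)
    {e : Finset (Fin d)} {i : Fin d} (hi : i ∈ e) (n : Fin d → ℕ) :
    ∃ C : ℝ≥0∞, C ≠ ⊤ ∧ ∀ f : (Fin d → ℝ) → ℂ, AEStronglyMeasurable f volume →
      orderNorm s e n p f ≤ C * (orderNorm s (e.erase i) (Function.update n i 0) p f +
        orderNorm s e (Function.update n i (n i + 1)) p f) := by
  obtain ⟨A, hA, hrec⟩ := exists_orderModulus_le hp n i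
  set θ : ℝ≥0∞ := ENNReal.ofReal (2 ^ s) with hθ
  have hθ1 : θ < 1 := by
    rw [hθ, ENNReal.ofReal_lt_one]
    exact Real.rpow_lt_one_of_one_lt_of_neg one_lt_two hs
  have hθi : (1 - θ)⁻¹ ≠ ⊤ := ENNReal.inv_ne_top.2 (tsub_pos_of_lt hθ1).ne'
  refine ⟨(1 - θ)⁻¹ * (2 ^ n i + A), ENNReal.mul_ne_top hθi
    (ENNReal.add_ne_top.2 ⟨by finiteness, hA⟩), fun f hf => ?_⟩
  set a' : {k : Fin d → ℕ // ∀ j, j ∉ e.erase i → k j = 0} → ℝ≥0∞ := fun k =>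
    ENNReal.ofReal ((2 : ℝ) ^ (∑ j, (s + (Function.update n i 0 j : ℕ)) * (k.1 j : ℝ))) *
      orderModulus (Function.update n i 0) p f fun j => (1 / 2 : ℝ) ^ k.1 j with ha'
  set b : {k : Fin d → ℕ // ∀ j, j ∉ e → k j = 0} → ℝ≥0∞ := fun k =>
    ENNReal.ofReal ((2 : ℝ) ^ (∑ j, (s + (Function.update n i (n i + 1) j : ℕ)) * (k.1 j : ℝ))) *
      orderModulus (Function.update n i (n i + 1)) p f fun j => (1 / 2 : ℝ) ^ k.1 j with hb
  set incl : {k : Fin d → ℕ // ∀ j, j ∉ e.erase i → k j = 0} →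
      {k : Fin d → ℕ // ∀ j, j ∉ e → k j = 0} := fun k =>
    ⟨k.1, fun j hj => k.2 j fun h => hj (Finset.mem_of_mem_erase h)⟩ with hincl
  have hincl_inj : Function.Injective incl := fun k k' h => Subtype.ext
    (congrArg (fun z : {k : Fin d → ℕ // ∀ j, j ∉ e → k j = 0} => z.1) h)
  set succ : {k : Fin d → ℕ // ∀ j, j ∉ e → k j = 0} →
      {k : Fin d → ℕ // ∀ j, j ∉ e → k j = 0} := fun k =>
    ⟨Function.update k.1 i (k.1 i + 1), fun j hj => by
      rw [Function.update_of_ne (by rintro rfl; exact hj hi)]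
      exact k.2 j hj⟩ with hsucc
  have hsucc_inj : Function.Injective succ := by
    intro k k' h
    have h1 : ∀ j, (succ k).1 j = (succ k').1 j := fun j => by rw [h]
    refine Subtype.ext (funext fun j => ?_)
    have h2 := h1 j
    by_cases hj : j = i
    · subst hj
      simpa [hsucc] using h2
    · simpa [hsucc, hj] using h2
  set c : {k : Fin d → ℕ // ∀ j, j ∉ e → k j = 0} → ℝ≥0∞ := fun k =>
    2 ^ n i * Function.extend incl a' 0 k + A * b k with hc
  have hmain := lpSum_le_of_recursion hp (lev := fun k => k.1 i) (c := c) (θ := θ)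
    (a := fun k : {k : Fin d → ℕ // ∀ j, j ∉ e → k j = 0} =>
      ENNReal.ofReal ((2 : ℝ) ^ (∑ j, (s + n j) * (k.1 j : ℝ))) *
        orderModulus n p f fun j => (1 / 2 : ℝ) ^ k.1 j)
    hsucc_inj (fun k => by simp [hsucc]) ?_ hθ1 ?_ ?_
  · refine hmain.trans ?_
    rw [mul_assoc]
    gcongr
    refine (lpSum_add_le hp _ _).trans ?_
    rw [lpSum_const_mul hp, lpSum_const_mul hp, lpSum_extend hp hincl_inj]
    change 2 ^ n i * orderNorm s (e.erase i) (Function.update n i 0) p f +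
      A * orderNorm s e (Function.update n i (n i + 1)) p f ≤ _
    rw [mul_add]
    gcongr
    · exact le_self_add
    · exact le_add_self
  · intro k hk
    refine ⟨⟨Function.update k.1 i (k.1 i - 1), fun j hj => ?_⟩, ?_⟩
    · rw [Function.update_of_ne (by rintro rfl; exact hj hi)]
      exact k.2 j hj
    · refine Subtype.ext (funext fun j => ?_)
      by_cases hj : j = i
      · subst hj
        simp only [hsucc, Function.update_self]
        have : k.1 j ≠ 0 := hk
        omega
      · simp [hsucc, hj]
  · intro k hk
    have hk0 : k.1 i = 0 := hk
    refine le_trans ?_ le_self_add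
    have hk' : k = incl ⟨k.1, fun j hj => by
        by_cases hji : j = i
        · rw [hji]; exact hk0
        · exact k.2 j fun h => hj (Finset.mem_erase.2 ⟨hji, h⟩)⟩ := rfl
    rw [hk', hincl_inj.extend_apply]
    simp only [ha', hincl]
    have hexp : ∑ j, (s + (Function.update n i 0 j : ℕ)) * (k.1 j : ℝ)
        = ∑ j, (s + n j) * (k.1 j : ℝ) := Finset.sum_congr rfl fun j _ => by
      by_cases hji : j = i
      · rw [hji, hk0]; simp
      · rw [Function.update_of_ne hji]
    rw [hexp, mul_left_comm]
    gcongr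
    exact orderModulus_le_update_zero hp n i hf _
  · intro k
    have hst : Function.update (fun j => (1 / 2 : ℝ) ^ (succ k).1 j) i
        (2 * (1 / 2 : ℝ) ^ (succ k).1 i) = fun j => (1 / 2 : ℝ) ^ k.1 j := by
      funext j
      by_cases hj : j = i
      · subst hj
        simp only [Function.update_self, hsucc, pow_succ]
        ring
      · simp [hsucc, hj]
    have h1 := hrec f hf fun j => (1 / 2 : ℝ) ^ (succ k).1 j
    rw [hst] at h1
    -- Raising `k_i` by one multiplies the weight by `2^(s + n_i)`. The Marchaud factor `2^(-n_i)`
    -- cancels all but `θ = 2^s`, and `θ < 1` because `s < 0`.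
    have hw : ENNReal.ofReal ((2 : ℝ) ^ (∑ j, (s + n j) * ((succ k).1 j : ℝ))) * 2⁻¹ ^ n i =
        θ * ENNReal.ofReal ((2 : ℝ) ^ (∑ j, (s + n j) * (k.1 j : ℝ))) := by
      have h2 : (2⁻¹ : ℝ≥0∞) ^ n i = ENNReal.ofReal (2⁻¹ ^ n i) := by
        rw [ENNReal.ofReal_pow (by norm_num), ENNReal.ofReal_inv_of_pos two_pos,
          ENNReal.ofReal_ofNat]
      rw [h2, hθ, ← ENNReal.ofReal_mul (by positivity), ← ENNReal.ofReal_mul (by positivity)]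
      congr 1
      have h3 : ∑ j, (s + n j) * ((succ k).1 j : ℝ) = _ :=
        sum_mul_update_succ (fun j => s + n j) k.1 i
      rw [h3, Real.rpow_add two_pos, Real.rpow_add two_pos, Real.rpow_natCast]
      have h4 : (2 : ℝ) ^ n i * 2⁻¹ ^ n i = 1 := by rw [← mul_pow]; simp
      linear_combination (2 ^ s * 2 ^ (∑ j, (s + n j) * (k.1 j : ℝ))) * h4
    have hw2 : ENNReal.ofReal ((2 : ℝ) ^ (∑ j, (s + n j) * ((succ k).1 j : ℝ))) ≤
        ENNReal.ofReal ((2 : ℝ) ^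
          (∑ j, (s + (Function.update n i (n i + 1) j : ℕ)) * ((succ k).1 j : ℝ))) := by
      refine ENNReal.ofReal_le_ofReal (Real.rpow_le_rpow_of_exponent_le one_le_two ?_)
      refine Finset.sum_le_sum fun j _ => ?_
      gcongr
      by_cases hj : j = i
      · subst hj; simp
      · simp [hj]
    calc ENNReal.ofReal ((2 : ℝ) ^ (∑ j, (s + n j) * ((succ k).1 j : ℝ))) *
          orderModulus n p f (fun j => (1 / 2 : ℝ) ^ (succ k).1 j)
        ≤ ENNReal.ofReal ((2 : ℝ) ^ (∑ j, (s + n j) * ((succ k).1 j : ℝ))) *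
          (2⁻¹ ^ n i * orderModulus n p f (fun j => (1 / 2 : ℝ) ^ k.1 j) +
            A * orderModulus (Function.update n i (n i + 1)) p f
              fun j => (1 / 2 : ℝ) ^ (succ k).1 j) := by gcongr
      _ = A * (ENNReal.ofReal ((2 : ℝ) ^ (∑ j, (s + n j) * ((succ k).1 j : ℝ))) *
            orderModulus (Function.update n i (n i + 1)) p f
              fun j => (1 / 2 : ℝ) ^ (succ k).1 j) +
          (ENNReal.ofReal ((2 : ℝ) ^ (∑ j, (s + n j) * ((succ k).1 j : ℝ))) * 2⁻¹ ^ n i) *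
            orderModulus n p f (fun j => (1 / 2 : ℝ) ^ k.1 j) := by ring
      _ ≤ c (succ k) + θ * (ENNReal.ofReal ((2 : ℝ) ^ (∑ j, (s + n j) * (k.1 j : ℝ))) *
            orderModulus n p f (fun j => (1 / 2 : ℝ) ^ k.1 j)) := by
          rw [hw, mul_assoc θ]
          gcongr
          exact (mul_le_mul' le_rfl (mul_le_mul' hw2 le_rfl)).trans le_add_self

/-- A direction of `e` whose order is below `m` is either dropped or raised by one order. Both moves
decrease the sum of order deficits over `e`, so the process ends at orders equal to `m` on the
remaining set, which are terms of the Besov norm. -/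
theorem exists_orderNorm_le_besovNorm {d : ℕ} {p : ℝ≥0∞} (hp : 1 ≤ p) {r : ℝ}
    (e : Finset (Fin d)) (n : Fin d → ℕ) (hn : ∀ i, n i ≤ ⌊r⌋₊ + 1) (hne : ∀ i, i ∉ e → n i = 0) :
    ∃ C : ℝ≥0∞, C ≠ ⊤ ∧ ∀ f : (Fin d → ℝ) → ℂ, AEStronglyMeasurable f volume →
      orderNorm (r - (⌊r⌋₊ + 1 : ℕ)) e n p f ≤ C * besovNorm r p f := by
  have hs : r - (⌊r⌋₊ + 1 : ℕ) < 0 := by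
    have := Nat.lt_floor_add_one r
    push_cast
    linarith
  induction hN : ∑ i ∈ e, (⌊r⌋₊ + 2 - n i) using Nat.strong_induction_on generalizing e n with
  | _ N ih =>
    by_cases hfull : ∀ i ∈ e, n i = ⌊r⌋₊ + 1
    · have : n = constOrder (⌊r⌋₊ + 1) e := by
        funext i
        by_cases hi : i ∈ e
        · simp [constOrder, hi, hfull i hi]
        · simp [constOrder, hi, hne i hi]
      refine ⟨1, ENNReal.one_ne_top, fun f _ => ?_⟩
      rw [one_mul, this]
      exact orderNorm_le_besovNorm r p f e
    · push Not at hfull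
      obtain ⟨i, hi, hni⟩ := hfull
      have hlt : n i < ⌊r⌋₊ + 1 := lt_of_le_of_ne (hn i) hni
      obtain ⟨C, hC, hle⟩ := exists_orderNorm_le hp hs hi n
      have hsum := Finset.add_sum_erase e (fun i => ⌊r⌋₊ + 2 - n i) hi
      obtain ⟨C₁, hC₁, h₁⟩ := ih (∑ j ∈ e.erase i, (⌊r⌋₊ + 2 - Function.update n i 0 j)) (by
          rw [← hN, ← hsum, Finset.sum_congr rfl fun j hj => by
            rw [Function.update_of_ne (Finset.ne_of_mem_erase hj)]]
          omega)
        (e.erase i) (Function.update n i 0)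
        (fun j => by
          by_cases hj : j = i
          · subst hj; simp
          · rw [Function.update_of_ne hj]; exact hn j)
        (fun j hj => by
          by_cases hji : j = i
          · subst hji; simp
          · rw [Function.update_of_ne hji]
            exact hne j fun h => hj (Finset.mem_erase.2 ⟨hji, h⟩)) rfl
      obtain ⟨C₂, hC₂, h₂⟩ := ih (∑ j ∈ e, (⌊r⌋₊ + 2 - Function.update n i (n i + 1) j)) (by
          rw [← hN, ← hsum, ← Finset.add_sum_erase e _ hi,
            Finset.sum_congr (s₁ := e.erase i) rfl fun j hj => by
              rw [Function.update_of_ne (Finset.ne_of_mem_erase hj)], Function.update_self]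
          omega)
        e (Function.update n i (n i + 1))
        (fun j => by
          by_cases hj : j = i
          · subst hj; rw [Function.update_self]; omega
          · rw [Function.update_of_ne hj]; exact hn j)
        (fun j hj => by
          rw [Function.update_of_ne (by rintro rfl; exact hj hi)]
          exact hne j hj) rfl
      refine ⟨C * (C₁ + C₂), ENNReal.mul_ne_top hC (ENNReal.add_ne_top.2 ⟨hC₁, hC₂⟩),
        fun f hf => (hle f hf).trans ?_⟩
      rw [mul_assoc, add_mul]
      gcongr
      · exact h₁ f hf
      · exact h₂ f hf

/-! ### The two inequalities -/

theorem constOrder_eq_or {d : ℕ} (m : ℕ) (e : Finset (Fin d)) (i : Fin d) :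
    constOrder m e i = m ∨ constOrder m e i = 0 := by
  unfold constOrder
  split_ifs <;> simp

theorem constOrder_le {d : ℕ} (m : ℕ) (e : Finset (Fin d)) (i : Fin d) :
    constOrder m e i ≤ m := by
  unfold constOrder
  split_ifs <;> simp

theorem constOrder_of_notMem {d : ℕ} (m : ℕ) {e : Finset (Fin d)} {i : Fin d} (hi : i ∉ e) :
    constOrder m e i = 0 := by
  simp [constOrder, hi]

theorem sum_order_mul_abs_le {d m : ℕ} {n : Fin d → ℕ} (hn : ∀ i, n i ≤ m) {N : ℕ}
    {v : Fin d → ℝ} (hv : ∀ i, |v i| ≤ N) : ∑ i, n i * |v i| ≤ ((d * (m * N) : ℕ) : ℝ) := by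
  calc ∑ i, n i * |v i| ≤ ∑ _i : Fin d, (m : ℝ) * N :=
        Finset.sum_le_sum fun i _ => mul_le_mul (by exact_mod_cast hn i) (hv i) (abs_nonneg _)
          (Nat.cast_nonneg _)
    _ = ((d * (m * N) : ℕ) : ℝ) := by simp

theorem half_pow_le_one (k : ℕ) : (1 / 2 : ℝ) ^ k ≤ 1 := pow_le_one₀ (by norm_num) (by norm_num)

/-- The weight of a Leibniz term: the factor `∏ |v_i|^{n_i - κ_i}` lowers the smoothness weight. -/
theorem weight_mul_prod_le {d m : ℕ} {n κ : Fin d → ℕ} (hκ : ∀ i, κ i ≤ n i)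
    (s : ℝ) {k : Fin d → ℕ} {v : Fin d → ℝ} (hv : ∀ i, |v i| < (m + 1) * (1 / 2 : ℝ) ^ k i) :
    (2 : ℝ) ^ (∑ i, (s + n i) * (k i : ℝ)) * ∏ i, |v i| ^ (n i - κ i) ≤
      (∏ i, (m + 1 : ℝ) ^ (n i - κ i)) * (2 : ℝ) ^ (∑ i, (s + κ i) * (k i : ℝ)) := by
  have h2 : ∀ w : Fin d → ℝ, (2 : ℝ) ^ (∑ i, w i) = ∏ i, (2 : ℝ) ^ w i := fun w =>
    Real.rpow_sum_of_pos two_pos _ _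
  rw [h2, h2, ← Finset.prod_mul_distrib, ← Finset.prod_mul_distrib]
  refine Finset.prod_le_prod (fun i _ => by positivity) fun i _ => ?_
  set a := n i - κ i with ha
  have hcast : ((n i : ℕ) : ℝ) = κ i + a := by
    rw [ha, Nat.cast_sub (hκ i)]; ring
  calc (2 : ℝ) ^ ((s + n i) * (k i : ℝ)) * |v i| ^ a
      ≤ (2 : ℝ) ^ ((s + n i) * (k i : ℝ)) * ((m + 1) * (1 / 2 : ℝ) ^ k i) ^ a := by
        gcongr
        exact (hv i).le
    _ = (m + 1 : ℝ) ^ a * ((2 : ℝ) ^ ((s + κ i) * (k i : ℝ)) *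
          ((2 : ℝ) ^ ((a * k i : ℕ) : ℝ) * (1 / 2) ^ (k i * a))) := by
        rw [hcast, show (s + (κ i + (a : ℝ))) * (k i : ℝ)
          = (s + κ i) * k i + ((a * k i : ℕ) : ℝ) by push_cast; ring, Real.rpow_add two_pos,
          mul_pow, ← pow_mul]
        ring
    _ = (m + 1 : ℝ) ^ a * (2 : ℝ) ^ ((s + κ i) * (k i : ℝ)) := by
        rw [Real.rpow_natCast, mul_comm a, ← mul_pow]
        norm_num

/-- At each dyadic scale the sum over `μ` is moved inside the supremum, the Leibniz estimate is
applied at a common step, and the resulting lower order norms are absorbed by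
`exists_orderNorm_le_besovNorm`. -/
theorem exists_lpSum_orderNorm_localize_le {d : ℕ} {p : ℝ≥0∞} (hp : 1 ≤ p) (r : ℝ)
    {ψ : (Fin d → ℝ) → ℝ} (hψ : ContDiff ℝ ∞ ψ) (hs : HasCompactSupport ψ)
    (e : Finset (Fin d)) :
    ∃ C : ℝ≥0∞, C ≠ ⊤ ∧ ∀ f : (Fin d → ℝ) → ℂ, AEStronglyMeasurable f volume →
      (lpSum p fun μ => orderNorm (r - (⌊r⌋₊ + 1 : ℕ)) e (constOrder (⌊r⌋₊ + 1) e) p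
        (localize ψ μ f)) ≤ C * besovNorm r p f := by
  set m := ⌊r⌋₊ + 1 with hm
  set n := constOrder m e with hn
  set s := r - (m : ℕ) with hs'
  obtain ⟨C₁, hC₁, h₁⟩ := exists_lpSum_orderModulus_le (d := d) (m := m) (Nat.succ_pos _) hp
    (constOrder_eq_or m e)
  -- Averaging has enlarged the steps to at most `m + 1`, so differences of order at most `m` in `d`
  -- directions reach no further than `d * (m * (m + 1))`.
  obtain ⟨C₂, hC₂, h₂⟩ := exists_lpSum_localize_le hp hψ hs n (d * (m * (m + 1)))
  set P := Fintype.piFinset fun i => range (n i + 1) with hP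
  have hPn : ∀ κ ∈ P, ∀ i, κ i ≤ n i := fun κ hκ i =>
    Nat.lt_succ_iff.1 (Finset.mem_range.1 (Fintype.mem_piFinset.1 hκ i))
  have h₃ : ∀ κ : Fin d → ℕ, ∃ C : ℝ≥0∞, C ≠ ⊤ ∧ (κ ∈ P →
      ∀ f : (Fin d → ℝ) → ℂ, AEStronglyMeasurable f volume →
        orderNorm s e κ p f ≤ C * besovNorm r p f) := fun κ => by
    by_cases hκ : κ ∈ P
    · obtain ⟨C, hC, h⟩ := exists_orderNorm_le_besovNorm hp (r := r) e κ
        (fun i => (hPn κ hκ i).trans (constOrder_le m e i))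
        (fun i hi => Nat.le_zero.1 ((hPn κ hκ i).trans (constOrder_of_notMem m hi).le))
      exact ⟨C, hC, fun _ => h⟩
    · exact ⟨0, ENNReal.zero_ne_top, fun h => absurd h hκ⟩
  choose C₃ hC₃ h₃ using h₃
  set D : (Fin d → ℕ) → ℝ≥0∞ := fun κ => ENNReal.ofReal (∏ i, (m + 1 : ℝ) ^ (n i - κ i)) *
    ∏ i, ((m + 1 : ℕ) : ℝ≥0∞) ^ κ i with hD
  have hDt : ∀ κ, D κ ≠ ⊤ := fun κ => ENNReal.mul_ne_top ENNReal.ofReal_ne_top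
    (ENNReal.prod_ne_top fun i _ => ENNReal.pow_ne_top (ENNReal.natCast_ne_top _))
  refine ⟨C₁ * C₂ * ∑ κ ∈ P, D κ * C₃ κ, ENNReal.mul_ne_top (ENNReal.mul_ne_top hC₁ hC₂)
    (ENNReal.sum_ne_top.2 fun κ _ => ENNReal.mul_ne_top (hDt κ) (hC₃ κ)), fun f hf => ?_⟩
  have hterm : ∀ k : {k : Fin d → ℕ // ∀ i, i ∉ e → k i = 0},
      (lpSum p fun μ => ENNReal.ofReal ((2 : ℝ) ^ (∑ i, (s + n i) * (k.1 i : ℝ))) *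
        orderModulus n p (localize ψ μ f) fun i => (1 / 2 : ℝ) ^ k.1 i) ≤
      (C₁ * C₂) * ∑ κ ∈ P, D κ * (ENNReal.ofReal ((2 : ℝ) ^ (∑ i, (s + κ i) * (k.1 i : ℝ))) *
        orderModulus κ p f fun i => (1 / 2 : ℝ) ^ k.1 i) := by
    intro k
    rw [lpSum_const_mul hp]
    refine (mul_le_mul' le_rfl (h₁ (Fin d → ℤ) (fun μ => localize ψ μ f)
      (fun μ => aestronglyMeasurable_localize hψ.continuous μ hf)
      (fun i => (1 / 2 : ℝ) ^ k.1 i) fun i => by positivity)).trans ?_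
    rw [mul_left_comm, mul_assoc C₁]
    refine mul_le_mul' le_rfl ?_
    simp only [ENNReal.mul_iSup]
    refine iSup₂_le fun v hv => ?_
    have hv1 : ∀ i, |v i| ≤ (m + 1 : ℕ) := fun i => by
      refine (hv i).le.trans ?_
      push_cast
      exact mul_le_of_le_one_right (by positivity) (half_pow_le_one _)
    refine (mul_le_mul' le_rfl
      (h₂ f hf v (sum_order_mul_abs_le (constOrder_le m e) hv1))).trans ?_
    rw [mul_left_comm, Finset.mul_sum]
    refine mul_le_mul' le_rfl (Finset.sum_le_sum fun κ hκ => ?_)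
    -- Splitting into `m + 1` smaller steps undoes the enlargement and returns to the modulus at
    -- scale `2^{-k}`.
    have hB := eLpNorm_le_pow_mul_orderModulus hp κ (N := m + 1) (Nat.succ_pos _) hf
      (t := fun i => (1 / 2 : ℝ) ^ k.1 i) (v := v) (fun i => by push_cast; exact hv i)
    have hW := ENNReal.ofReal_le_ofReal (weight_mul_prod_le (hPn κ hκ) s hv)
    rw [ENNReal.ofReal_mul (by positivity), ENNReal.ofReal_mul (by positivity)] at hW
    calc _ ≤ ENNReal.ofReal ((2 : ℝ) ^ (∑ i, (s + n i) * (k.1 i : ℝ))) *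
          (ENNReal.ofReal (∏ i, |v i| ^ (n i - κ i)) * ((∏ i, ((m + 1 : ℕ) : ℝ≥0∞) ^ κ i) *
            orderModulus κ p f fun i => (1 / 2 : ℝ) ^ k.1 i)) := by gcongr
      _ = (ENNReal.ofReal ((2 : ℝ) ^ (∑ i, (s + n i) * (k.1 i : ℝ))) *
          ENNReal.ofReal (∏ i, |v i| ^ (n i - κ i))) * ((∏ i, ((m + 1 : ℕ) : ℝ≥0∞) ^ κ i) *
            orderModulus κ p f fun i => (1 / 2 : ℝ) ^ k.1 i) := by ring
      _ ≤ _ := mul_le_mul' hW le_rfl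
      _ = _ := by rw [hD]; ring
  calc (lpSum p fun μ => orderNorm s e n p (localize ψ μ f))
      = lpSum p fun k : {k : Fin d → ℕ // ∀ i, i ∉ e → k i = 0} => lpSum p fun μ =>
          ENNReal.ofReal ((2 : ℝ) ^ (∑ i, (s + n i) * (k.1 i : ℝ))) *
            orderModulus n p (localize ψ μ f) fun i => (1 / 2 : ℝ) ^ k.1 i := lpSum_comm hp _
    _ ≤ lpSum p fun k : {k : Fin d → ℕ // ∀ i, i ∉ e → k i = 0} => (C₁ * C₂) * ∑ κ ∈ P,
          D κ * (ENNReal.ofReal ((2 : ℝ) ^ (∑ i, (s + κ i) * (k.1 i : ℝ))) *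
            orderModulus κ p f fun i => (1 / 2 : ℝ) ^ k.1 i) := lpSum_mono hterm
    _ ≤ C₁ * C₂ * ∑ κ ∈ P, D κ * orderNorm s e κ p f := by
        rw [lpSum_const_mul hp]
        gcongr
        refine (lpSum_sum_le hp _ _).trans (le_of_eq ?_)
        exact Finset.sum_congr rfl fun κ _ => lpSum_const_mul hp _ _
    _ ≤ C₁ * C₂ * ∑ κ ∈ P, D κ * (C₃ κ * besovNorm r p f) := by
        gcongr with κ hκ
        exact h₃ κ hκ f hf
    _ = C₁ * C₂ * (∑ κ ∈ P, D κ * C₃ κ) * besovNorm r p f := by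
        simp only [← mul_assoc, ← Finset.sum_mul]

theorem exists_lpSum_besovNorm_localize_le {d : ℕ} {p : ℝ≥0∞} (hp : 1 ≤ p) (r : ℝ)
    {ψ : (Fin d → ℝ) → ℝ} (hψ : ContDiff ℝ ∞ ψ) (hs : HasCompactSupport ψ) :
    ∃ C : ℝ≥0∞, C ≠ ⊤ ∧ ∀ f : (Fin d → ℝ) → ℂ, AEStronglyMeasurable f volume →
      (lpSum p fun μ => besovNorm r p (localize ψ μ f)) ≤ C * besovNorm r p f := by
  choose C hC h using fun e : Finset (Fin d) => exists_lpSum_orderNorm_localize_le hp r hψ hs e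
  refine ⟨∑ e, C e, ENNReal.sum_ne_top.2 fun e _ => hC e, fun f hf => ?_⟩
  simp only [besovNorm_eq_sum_orderNorm r p (localize ψ _ f)]
  refine (lpSum_sum_le hp _ _).trans ?_
  rw [Finset.sum_mul]
  exact Finset.sum_le_sum fun e _ => h e f hf

/-- On the ball of radius `L` around `x` only the listed `ψ_μ` are nonzero and they sum to 1. Thus
`f` minus the finite sum of localizations vanishes there, and locality of `a` applies to this
difference. -/
theorem act_eq_sum_localize {d : ℕ} {ψ : (Fin d → ℝ) → ℝ} {ρ L : ℕ}
    (hρ : ∀ x, (ρ : ℝ) < ‖x‖ → ψ x = 0)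
    (hsum : ∀ x : Fin d → ℝ, HasSum (fun μ : Fin d → ℤ => ψ (fun i => x i - (μ i : ℝ))) 1)
    {a : TransAlg d} (ha : IsLocal L a) (f : (Fin d → ℝ) → ℂ) (x : Fin d → ℝ) :
    act a f x = ∑ μ ∈ latticeBall (ρ + L) x, act a (localize ψ μ f) x := by
  have h := ha (f - ∑ μ ∈ latticeBall (ρ + L) x, localize ψ μ f) x fun y hy => ?_
  · rw [map_sub, map_sum, Pi.sub_apply, Finset.sum_apply, sub_eq_zero] at h
    exact h
  · have h1 : ∑ μ ∈ latticeBall (ρ + L) x, ψ (fun i => y i - (μ i : ℝ)) = 1 := by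
      refine (hasSum_sum_of_ne_finset_zero fun μ hμ => ?_).unique (hsum y)
      refine hρ (y - fun i => (μ i : ℝ)) ?_
      have h1 := lt_norm_of_notMem_latticeBall hμ
      have h2 : ‖x - fun i => (μ i : ℝ)‖ ≤ ‖y - x‖ + ‖y - fun i => (μ i : ℝ)‖ := by
        rw [← norm_neg (y - x)]
        refine le_trans (le_of_eq ?_) (norm_add_le _ _)
        congr 1
        abel
      push_cast at h1
      linarith
    rw [Pi.sub_apply, Finset.sum_apply]
    simp only [localize]
    rw [← Finset.sum_mul, ← Complex.ofReal_sum, h1]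
    simp

/-- Here the supremum over steps is on the favourable side: each difference of `ψ_μ f` is at most
its own modulus, so no averaging is needed. -/
theorem exists_besovNorm_le_lpSum_localize {d : ℕ} {p : ℝ≥0∞} (hp : 1 ≤ p) (r : ℝ)
    {ψ : (Fin d → ℝ) → ℝ} (hψ : Continuous ψ) (hs : HasCompactSupport ψ)
    (hsum : ∀ x : Fin d → ℝ, HasSum (fun μ : Fin d → ℤ => ψ (fun i => x i - (μ i : ℝ))) 1) :
    ∃ C : ℝ≥0∞, C ≠ ⊤ ∧ ∀ f : (Fin d → ℝ) → ℂ, AEStronglyMeasurable f volume →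
      besovNorm r p f ≤ C * lpSum p fun μ => besovNorm r p (localize ψ μ f) := by
  obtain ⟨ρ, hρ⟩ := exists_radius hs
  set m := ⌊r⌋₊ + 1 with hm
  -- The dyadic steps are at most 1, so this bounds the reach of all differences that occur.
  set L := d * (m * 1) with hL
  set N : ℕ := (2 * (ρ + L) + 1) ^ d with hN
  refine ⟨(#(univ : Finset (Finset (Fin d))) : ℕ) * N, ENNReal.mul_ne_top
    (ENNReal.natCast_ne_top _) (ENNReal.natCast_ne_top _), fun f hf => ?_⟩
  have hmod : ∀ (e : Finset (Fin d)) (t : Fin d → ℝ), (∀ i, t i ≤ 1) →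
      orderModulus (constOrder m e) p f t ≤
        N * lpSum p fun μ => orderModulus (constOrder m e) p (localize ψ μ f) t := by
    intro e t ht
    refine iSup₂_le fun h hh => ?_
    have hloc : IsLocal (L : ℝ) (multiDiff (constOrder m e) h) :=
      (isLocal_multiDiff _ h).mono (sum_order_mul_abs_le (constOrder_le m e) fun i => by
        simpa using (hh i).le.trans (ht i))
    refine (eLpNorm_le_lpSum_of_overlap hp (fun μ => aestronglyMeasurable_act _
      (aestronglyMeasurable_localize hψ μ hf)) (latticeBall (ρ + L)) (card_latticeBall_le _)
      (act_eq_sum_localize hρ hsum hloc f)).trans ?_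
    gcongr
    exact lpSum_mono fun μ => eLpNorm_le_orderModulus _ p _ hh
  rw [besovNorm_eq_sum_orderNorm, mul_assoc, ← nsmul_eq_mul]
  refine Finset.sum_le_card_nsmul _ _ _ fun e _ => ?_
  calc orderNorm (r - (m : ℕ)) e (constOrder m e) p f
      ≤ lpSum p fun k : {k : Fin d → ℕ // ∀ i, i ∉ e → k i = 0} => N * lpSum p fun μ =>
          ENNReal.ofReal ((2 : ℝ) ^ (∑ i, (r - (m : ℕ) + constOrder m e i) * (k.1 i : ℝ))) *
            orderModulus (constOrder m e) p (localize ψ μ f) fun i => (1 / 2 : ℝ) ^ k.1 i := by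
        refine lpSum_mono fun k => ?_
        rw [lpSum_const_mul hp, mul_left_comm]
        gcongr
        exact hmod e _ fun i => half_pow_le_one _
    _ = N * lpSum p fun μ => orderNorm (r - (m : ℕ)) e (constOrder m e) p (localize ψ μ f) := by
        rw [lpSum_const_mul hp, lpSum_comm hp]
        rfl
    _ ≤ N * lpSum p fun μ => besovNorm r p (localize ψ μ f) := by
        gcongr
        exact lpSum_mono fun μ => orderNorm_le_besovNorm r p _ e

theorem memLp_localize {d : ℕ} {p : ℝ≥0∞} {ψ : (Fin d → ℝ) → ℝ} (hψ : Continuous ψ)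
    (hs : HasCompactSupport ψ) (μ : Fin d → ℤ) {f : (Fin d → ℝ) → ℂ} (hf : MemLp f p volume) :
    MemLp (localize ψ μ f) p volume := by
  obtain ⟨C, hC⟩ := hψ.bounded_above_of_compact_support hs
  refine hf.of_le_mul (c := C) (aestronglyMeasurable_localize hψ μ hf.1) (ae_of_all _ fun x => ?_)
  rw [localize, norm_mul, Complex.norm_real]
  gcongr
  exact hC _

end MixedBesov

theorem proposition4p3 (d : ℕ) (hd : 1 ≤ d) (p : ℝ≥0∞) (hp : 1 ≤ p) (r : ℝ) (hr : 0 < r)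
    (ψ : (Fin d → ℝ) → ℝ) (hψ_smooth : ContDiff ℝ ∞ ψ) (hψ_supp : HasCompactSupport ψ)
    (hψ_nonneg : ∀ x, 0 ≤ ψ x)
    (hψ_sum : ∀ x : Fin d → ℝ, HasSum (fun μ : Fin d → ℤ => ψ (fun i => x i - (μ i : ℝ))) 1) :
    ∃ c C : ℝ, 0 < c ∧ 0 < C ∧
      ∀ f : (Fin d → ℝ) → ℂ, MixedBesov.MemBesov r p f →
        (∀ μ : Fin d → ℤ, MixedBesov.MemBesov r p (MixedBesov.localize ψ μ f)) ∧
        ENNReal.ofReal c * MixedBesov.besovNorm r p f ≤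
          MixedBesov.lpSum p
            (fun μ : Fin d → ℤ => MixedBesov.besovNorm r p (MixedBesov.localize ψ μ f)) ∧
        MixedBesov.lpSum p
            (fun μ : Fin d → ℤ => MixedBesov.besovNorm r p (MixedBesov.localize ψ μ f)) ≤
          ENNReal.ofReal C * MixedBesov.besovNorm r p f := by
  obtain ⟨A, hA, hlow⟩ := MixedBesov.exists_besovNorm_le_lpSum_localize hp r hψ_smooth.continuous
    hψ_supp hψ_sum
  obtain ⟨B, hB, hup⟩ := MixedBesov.exists_lpSum_besovNorm_localize_le hp r hψ_smooth hψ_supp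
  -- Adding 1 yields strictly positive real constants even if `A` or `B` is 0.
  have hA1 : A ≤ ENNReal.ofReal (A.toReal + 1) :=
    ENNReal.le_ofReal_iff_toReal_le hA (by positivity) |>.2 (by linarith)
  have hB1 : B ≤ ENNReal.ofReal (B.toReal + 1) :=
    ENNReal.le_ofReal_iff_toReal_le hB (by positivity) |>.2 (by linarith)
  refine ⟨(A.toReal + 1)⁻¹, B.toReal + 1, by positivity, by positivity, fun f hf => ?_⟩
  have hf1 := hf.1.1
  refine ⟨fun μ => ⟨MixedBesov.memLp_localize hψ_smooth.continuous hψ_supp μ hf.1, ?_⟩, ?_, ?_⟩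
  · refine ((MixedBesov.le_lpSum hp _ μ).trans (hup f hf1)).trans_lt ?_
    exact ENNReal.mul_lt_top hB.lt_top hf.2
  · have hpos : (0 : ℝ) < A.toReal + 1 := by positivity
    rw [ENNReal.ofReal_inv_of_pos hpos,
      ENNReal.inv_mul_le_iff (by simpa using hpos) ENNReal.ofReal_ne_top]
    exact (hlow f hf1).trans (by gcongr)
  · exact (hup f hf1).trans (by gcongr)
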